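/- For a finite group $G$, a set $\{C_1,\dots,C_t\}$ of conjugacy classes of $G$ is said to *invariably generate* $G$ if $\langle x_1,\dots,x_t\rangle=G$ for every choice of $x_1\in C_1,\dots,x_t\in C_t$. Let $\Psi_2(G)$ denote the set of ordered pairs $(C_1,C_2)$ of conjugacy classes of $G$ such that $\{C_1,C_2\}$ invariably generates $G$. **Theorem.** There is an absolute constant $K$ such that for every prime power $q\ge 4$, setting $S=\mathrm{PSL}_2(q)$ and $d=\gcd(2,q-1)$, $$\left|\,|\Psi_2(S)|-\frac{q^2}{2d^2}\,\right|\le Kq.$$ In other words, $|\Psi_2(S)|=\frac{q^2}{2d^2}+O(q)$. -/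

import Mathlib

/-- A set `X` of conjugacy classes of `G` invariably generates `G` if, whenever one representative
`x C ∈ C` is chosen for each `C ∈ X`, the chosen representatives generate `G`. -/
def InvariablyGenerates {G : Type*} [Group G] (X : Set (ConjClasses G)) : Prop :=
  ∀ x : ConjClasses G → G, (∀ C ∈ X, x C ∈ C.carrier) → Subgroup.closure (x '' X) = ⊤

/-- The set `Ψ₂(G)` of all ordered pairs `(C₁, C₂)` of conjugacy classes of `G` such that
`{C₁, C₂}` invariably generates `G`. -/
def invGenPairs (G : Type*) [Group G] : Set (ConjClasses G × ConjClasses G) :=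
  {P | InvariablyGenerates {P.1, P.2}}

/-! Away from trace ±2, a class of PSL₂(q) is determined by its trace up to sign, and it is split or
nonsplit according to whether the eigenvalues lie in F. The classes of trace ±2 number at most
three, so pairs involving them contribute O(q). Two split classes have representatives in one torus,
and so do two nonsplit classes. Commuting elements cannot generate, so only mixed pairs survive.
There are about q/(2d) classes of each type, hence about 2·(q/(2d))² = q²/(2d²) ordered mixed pairs.

It remains to show that all but O(q) mixed pairs do invariably generate. Dickson's list of subgroups
is replaced by a fixed-point count (`eq_top_or_exists_subfield`). Let H contain the centre Z, a
split element and a nonsplit element, neither of whose twelfth powers is 1. On the projective line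
over the algebraic closure, every noncentral element has two fixed points, or one that is counted
twice. Choose coordinates so that the split element fixes ∞, and let k be a fixed point of the
nonsplit one. The orbits of ∞ and k have stabilizers of order at least 4|Z|, and a third orbit with
a noncentral stabilizer would exceed the total count. The resulting equality, with the
divisibilities coming from the Borel subgroup of H, forces the orbit of ∞ to be a scaled projective
line over a subfield E. If E = F then H is everything; otherwise every squared trace of H lies in
the proper subfield E.

Exceptional pairs therefore have a trace from a set of at most 12 elements, or both squared traces
in a proper subfield E. The latter number at most 4|E|² for each E. The |E|² are distinct powers of
the characteristic not exceeding q, so their sum is at most 2q. -/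

namespace SL2Aux

open scoped MatrixGroups

/-! ### Conjugacy in SL₂(F) and the trace. -/

section Conjugacy

variable {F : Type*} [Field F]

/-- The trace of an element of `SL(2, F)`. -/
def tr (g : SL(2, F)) : F := g 0 0 + g 1 1

lemma det_eq_one (g : SL(2, F)) : g 0 0 * g 1 1 - g 0 1 * g 1 0 = 1 := by
  have := g.det_coe
  rwa [Matrix.det_fin_two] at this

lemma ext_entries {g h : SL(2, F)} (h00 : g 0 0 = h 0 0) (h01 : g 0 1 = h 0 1)
    (h10 : g 1 0 = h 1 0) (h11 : g 1 1 = h 1 1) : g = h := by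
  ext i j
  fin_cases i <;> fin_cases j <;> simpa

lemma mul_00 (g h : SL(2, F)) : (g * h) 0 0 = g 0 0 * h 0 0 + g 0 1 * h 1 0 := by
  simp [Matrix.mul_apply, Fin.sum_univ_two]
lemma mul_01 (g h : SL(2, F)) : (g * h) 0 1 = g 0 0 * h 0 1 + g 0 1 * h 1 1 := by
  simp [Matrix.mul_apply, Fin.sum_univ_two]
lemma mul_10 (g h : SL(2, F)) : (g * h) 1 0 = g 1 0 * h 0 0 + g 1 1 * h 1 0 := by
  simp [Matrix.mul_apply, Fin.sum_univ_two]
lemma mul_11 (g h : SL(2, F)) : (g * h) 1 1 = g 1 0 * h 0 1 + g 1 1 * h 1 1 := by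
  simp [Matrix.mul_apply, Fin.sum_univ_two]

lemma inv_00 (g : SL(2, F)) : g⁻¹ 0 0 = g 1 1 := by
  simp [Matrix.SpecialLinearGroup.coe_inv, Matrix.adjugate_fin_two]
lemma inv_01 (g : SL(2, F)) : g⁻¹ 0 1 = - g 0 1 := by
  simp [Matrix.SpecialLinearGroup.coe_inv, Matrix.adjugate_fin_two]
lemma inv_10 (g : SL(2, F)) : g⁻¹ 1 0 = - g 1 0 := by
  simp [Matrix.SpecialLinearGroup.coe_inv, Matrix.adjugate_fin_two]
lemma inv_11 (g : SL(2, F)) : g⁻¹ 1 1 = g 0 0 := by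
  simp [Matrix.SpecialLinearGroup.coe_inv, Matrix.adjugate_fin_two]

/-- The element of `SL(2, F)` with the given entries. -/
def mk (a b c d : F) (h : a * d - b * c = 1) : SL(2, F) :=
  ⟨!![a, b; c, d], by rw [Matrix.det_fin_two_of, h]⟩

@[simp] lemma mk_00 (a b c d : F) (h : a * d - b * c = 1) : mk a b c d h 0 0 = a := rfl
@[simp] lemma mk_01 (a b c d : F) (h : a * d - b * c = 1) : mk a b c d h 0 1 = b := rfl
@[simp] lemma mk_10 (a b c d : F) (h : a * d - b * c = 1) : mk a b c d h 1 0 = c := rfl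
@[simp] lemma mk_11 (a b c d : F) (h : a * d - b * c = 1) : mk a b c d h 1 1 = d := rfl

@[simp] lemma one_00 : (1 : SL(2, F)) 0 0 = 1 := rfl
@[simp] lemma one_01 : (1 : SL(2, F)) 0 1 = 0 := rfl
@[simp] lemma one_10 : (1 : SL(2, F)) 1 0 = 0 := rfl
@[simp] lemma one_11 : (1 : SL(2, F)) 1 1 = 1 := rfl

@[simp] lemma neg_00 (g : SL(2, F)) : (-g) 0 0 = - g 0 0 := rfl
@[simp] lemma neg_01 (g : SL(2, F)) : (-g) 0 1 = - g 0 1 := rfl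
@[simp] lemma neg_10 (g : SL(2, F)) : (-g) 1 0 = - g 1 0 := rfl
@[simp] lemma neg_11 (g : SL(2, F)) : (-g) 1 1 = - g 1 1 := rfl

lemma tr_conj (k g : SL(2, F)) : tr (k * g * k⁻¹) = tr g := by
  have := det_eq_one k
  simp only [tr, mul_00, mul_01, mul_10, mul_11, inv_00, inv_01, inv_10, inv_11]
  linear_combination (g 0 0 + g 1 1) * this

lemma tr_neg (g : SL(2, F)) : tr (-g) = - tr g := by simp [tr]; ring

/-- The matrix of trace `t` of an endomorphism `g` in a basis `v, δ⁻¹ g v`. -/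
def stdForm (t δ : F) (h : δ ≠ 0) : SL(2, F) := mk 0 (-δ⁻¹) δ t (by field_simp; ring)

lemma tr_stdForm (t δ : F) (h : δ ≠ 0) : tr (stdForm t δ h) = t := by simp [stdForm, tr]

/-- For v = (x, y), the quadratic form in the hypothesis is det(v, gv). The basis v, δ⁻¹gv therefore
has determinant 1, which keeps the change of basis inside SL₂. Conjugacy thus reduces to the values
taken by a binary quadratic form. -/
lemma isConj_stdForm (g : SL(2, F)) (x y δ : F) (hδ : δ ≠ 0)
    (h : g 1 0 * x ^ 2 + (g 1 1 - g 0 0) * x * y - g 0 1 * y ^ 2 = δ) :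
    IsConj (stdForm (tr g) δ hδ) g := by
  have hg := det_eq_one g
  rw [isConj_iff]
  refine ⟨mk x ((g 0 0 * x + g 0 1 * y) / δ) y ((g 1 0 * x + g 1 1 * y) / δ) ?_, ?_⟩
  · field_simp; linear_combination h
  · rw [mul_inv_eq_iff_eq_mul]
    apply ext_entries <;> simp only [mul_00, mul_01, mul_10, mul_11, stdForm, mk_00, mk_01, mk_10,
      mk_11, tr] <;> field_simp
    · ring
    · linear_combination x * hg
    · ring
    · linear_combination y * hg

/-- If det(v, gv) vanished for all v, every vector would be an eigenvector and g would be scalar. -/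
lemma exists_form_ne_zero (g : SL(2, F)) (h : g ≠ 1) (h' : g ≠ -1) :
    ∃ x y : F, g 1 0 * x ^ 2 + (g 1 1 - g 0 0) * x * y - g 0 1 * y ^ 2 ≠ 0 := by
  by_contra! H
  have h1 := H 1 0
  have h2 := H 0 1
  have h3 := H 1 1
  have hc : g 1 0 = 0 := by linear_combination h1
  have hb : g 0 1 = 0 := by linear_combination -h2
  have hd : g 1 1 = g 0 0 := by linear_combination h3 - h1 - h2
  have hg := det_eq_one g
  rw [hc, hb, hd] at hg
  have : (g 0 0 - 1) * (g 0 0 + 1) = 0 := by linear_combination hg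
  rcases mul_eq_zero.1 this with e | e
  · have e : g 0 0 = 1 := by linear_combination e
    exact h (ext_entries (by simp [e]) (by simp [hb]) (by simp [hc]) (by simp [hd, e]))
  · have e : g 0 0 = -1 := by linear_combination e
    exact h' (ext_entries (by simp [e]) (by simp [hb]) (by simp [hc]) (by simp [hd, e]))

lemma exists_binary_form_eq_one [Finite F] (A B C : F) (h : B ^ 2 - 4 * A * C ≠ 0) :
    ∃ x y : F, A * x ^ 2 + B * x * y + C * y ^ 2 = 1 := by
  have := Fintype.ofFinite F
  by_cases hA : A = 0
  · subst hA
    have hB : B ≠ 0 := by rintro rfl; simp at h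
    exact ⟨(1 - C) / B, 1, by field_simp; ring⟩
  by_cases h2 : ringChar F = 2
  · obtain ⟨s, hs⟩ := FiniteField.isSquare_of_char_two h2 (A⁻¹)
    refine ⟨s, 0, ?_⟩
    have : A * (s * s) = 1 := by rw [← hs, mul_inv_cancel₀ hA]
    linear_combination this
  · have hodd : Fintype.card F % 2 = 1 := FiniteField.odd_card_of_char_ne_two h2
    -- Completing the square with u = 2Ax + By turns the equation into u² + (4AC - B²)y² = 4A, which
    -- is solvable by the pigeonhole principle on two quadratics.
    have two : (2 : F) ≠ 0 := Ring.two_ne_zero h2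
    have hD : 4 * A * C - B ^ 2 ≠ 0 := fun e => h (by linear_combination -e)
    obtain ⟨u, y, huy⟩ := FiniteField.exists_root_sum_quadratic
      (f := (Polynomial.X ^ 2 : Polynomial F))
      (g := Polynomial.C (4 * A * C - B ^ 2) * Polynomial.X ^ 2 + Polynomial.C 0 * Polynomial.X
        + Polynomial.C (- (4 * A)))
      (Polynomial.degree_X_pow 2) (Polynomial.degree_quadratic hD) hodd
    refine ⟨(u - B * y) / (2 * A), y, ?_⟩
    simp at huy
    field_simp
    linear_combination huy

lemma isConj_stdForm_one [Finite F] (g : SL(2, F)) (h : tr g ^ 2 ≠ 4) :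
    IsConj (stdForm (tr g) 1 one_ne_zero) g := by
  have hg := det_eq_one g
  -- The discriminant of det(v, gv) is tr² - 4, so the form is nondegenerate here and represents 1.
  obtain ⟨x, y, hxy⟩ := exists_binary_form_eq_one (g 1 0) (g 1 1 - g 0 0) (- g 0 1) (by
    contrapose h; simp only [tr] at *; linear_combination h + 4 * hg)
  exact isConj_stdForm g x y 1 one_ne_zero (by linear_combination hxy)

lemma isConj_of_tr_eq [Finite F] {g h : SL(2, F)} (e : tr g = tr h) (hg : tr g ^ 2 ≠ 4) :
    IsConj g h := by
  have h1 := isConj_stdForm_one g hg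
  have h2 := isConj_stdForm_one h (e ▸ hg)
  rw [← e] at h2
  exact h1.symm.trans h2

lemma isSquare_mul_of_not_isSquare [Finite F] {a b : F} (ha : ¬ IsSquare a) (hb : ¬ IsSquare b) :
    IsSquare (a * b) := by
  classical
  have := Fintype.ofFinite F
  have h0 : a * b ≠ 0 := mul_ne_zero (fun h => ha (h ▸ IsSquare.zero))
    (fun h => hb (h ▸ IsSquare.zero))
  rw [← quadraticChar_one_iff_isSquare h0, map_mul,
    quadraticChar_neg_one_iff_not_isSquare.2 ha, quadraticChar_neg_one_iff_not_isSquare.2 hb]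
  norm_num

lemma exists_nonsquare_class (F : Type*) [Field F] [Finite F] :
    ∃ ν : F, ν ≠ 0 ∧ ∀ δ : F, δ ≠ 0 → ∃ s : F, δ * s ^ 2 = 1 ∨ δ * s ^ 2 = ν := by
  by_cases h : ∀ x : F, IsSquare x
  · refine ⟨1, one_ne_zero, fun δ hδ => ?_⟩
    obtain ⟨s, hs⟩ := h δ⁻¹
    exact ⟨s, Or.inl (by rw [sq, ← hs, mul_inv_cancel₀ hδ])⟩
  push Not at h
  obtain ⟨ν, hν⟩ := h
  have hν0 : ν ≠ 0 := by rintro rfl; exact hν IsSquare.zero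
  refine ⟨ν, hν0, fun δ hδ => ?_⟩
  by_cases hs : IsSquare δ⁻¹
  · obtain ⟨s, hs⟩ := hs
    exact ⟨s, Or.inl (by rw [sq, ← hs, mul_inv_cancel₀ hδ])⟩
  · have h2 : IsSquare (ν * δ⁻¹) := isSquare_mul_of_not_isSquare hν hs
    obtain ⟨s, hs⟩ := h2
    exact ⟨s, Or.inr (by rw [sq, ← hs]; field_simp)⟩

end Conjugacy

/-! ### Counting fixed points when each noncentral element fixes one or two points. -/

section OrbitCounting

open MulAction Finset

variable {G X : Type*} [Group G] [MulAction G X]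

lemma card_orbit_mul_card_stabilizer (P : X) :
    Nat.card (orbit G P) * Nat.card (stabilizer G P) = Nat.card G := by
  rw [← Nat.card_prod]
  exact Nat.card_congr (orbitProdStabilizerEquivGroup G P)

open Classical in
-- A unique fixed point is counted once as fixed and once as sole, so each element has weight 2
-- whether or not a = b.
lemma card_fixed_add_card_sole_le (S : Finset X) {g : G} {a b : X}
    (h : fixedBy X g = {a, b}) :
    (S.filter (fun P => g • P = P)).card + (S.filter (fun P => fixedBy X g = {P})).card ≤ 2 ∧
    (a ∈ S → b ∈ S → (S.filter (fun P => g • P = P)).card +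
      (S.filter (fun P => fixedBy X g = {P})).card = 2) := by
  have h1 : ∀ P, g • P = P ↔ P = a ∨ P = b := by
    intro P
    have : P ∈ fixedBy X g ↔ P ∈ ({a, b} : Set X) := by rw [h]
    simpa using this
  by_cases hab : a = b
  · subst hab
    have h2 : ∀ P, fixedBy X g = {P} ↔ P = a := by
      intro P; rw [h]; simp [eq_comm]
    simp only [h1, h2, or_self]
    have e : ∀ inst : DecidablePred (fun P => P = a),
        (@Finset.filter _ (fun P => P = a) inst S).card = if a ∈ S then 1 else 0 := by
      intro inst
      split_ifs with ha
      · rw [Finset.card_eq_one]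
        exact ⟨a, by ext P; simp only [mem_filter, mem_singleton]; grind⟩
      · rw [Finset.card_eq_zero]
        ext P; simp only [mem_filter, notMem_empty]; grind
    rw [e]
    split_ifs with ha <;> simp [ha]
  · have h2 : ∀ P, ¬ fixedBy X g = {P} := by
      intro P e
      rw [h] at e
      have ha : a ∈ ({P} : Set X) := e ▸ Set.mem_insert a {b}
      have hb : b ∈ ({P} : Set X) := e ▸ Set.mem_insert_of_mem a rfl
      exact hab (ha.trans hb.symm)
    simp only [h1, h2, Finset.filter_false, Finset.card_empty, add_zero]
    constructor
    · calc _ ≤ ({a, b} : Finset X).card := Finset.card_le_card (by intro P; simp)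
        _ ≤ 2 := Finset.card_le_two
    · intro ha hb
      rw [← Finset.card_pair hab]
      congr 1
      ext P
      simp only [mem_filter, mem_insert, mem_singleton]
      constructor
      · exact fun h => h.2
      · rintro (rfl | rfl) <;> simp [ha, hb]

variable [Fintype G] (Z : Subgroup G)

open Classical in
/-- The elements outside `Z` that fix `P`. -/
noncomputable def fixers (P : X) : Finset G := {g | g ∉ Z ∧ g • P = P}

open Classical in
/-- The elements outside `Z` that fix `P` and no other point. -/
noncomputable def soleFixers (P : X) : Finset G := {g | g ∉ Z ∧ fixedBy X g = {P}}

variable {Z}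

lemma card_fixers (hZ : ∀ g ∈ Z, ∀ x : X, g • x = x) (P : X) :
    (fixers Z P).card + Nat.card Z = Nat.card (stabilizer G P) := by
  classical
  have h1 : Nat.card Z = (univ.filter (fun g : G => g ∈ Z)).card := by
    rw [Nat.card_eq_fintype_card, Fintype.card_subtype]
  have h2 : Nat.card (stabilizer G P) = (univ.filter (fun g : G => g • P = P)).card := by
    rw [Nat.card_eq_fintype_card, Fintype.card_subtype]
    congr 1
  rw [h1, h2, fixers, ← Finset.card_union_of_disjoint]
  · congr 1
    ext g
    simp only [mem_union, mem_filter, mem_univ, true_and]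
    have := hZ g
    grind
  · rw [Finset.disjoint_left]
    intro g
    simp only [mem_filter, mem_univ, true_and]
    tauto

lemma card_compl (Z : Subgroup G) [DecidablePred (· ∈ Z)] :
    (univ.filter (fun g : G => g ∉ Z)).card + Nat.card Z = Nat.card G := by
  have h1 : Nat.card Z = (univ.filter (fun g : G => g ∈ Z)).card := by
    rw [Nat.card_eq_fintype_card, Fintype.card_subtype]
  rw [h1, Nat.card_eq_fintype_card, ← Finset.card_univ, add_comm]
  exact Finset.card_filter_add_card_filter_not _

lemma sum_card_eq (S : Finset X) :
    ∑ P ∈ S, ((fixers Z P).card + (soleFixers Z P).card) =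
      by classical exact ∑ g ∈ univ.filter (fun g : G => g ∉ Z),
        ((S.filter (fun P => g • P = P)).card +
          (S.filter (fun P => fixedBy X g = {P})).card) := by
  classical
  rw [Finset.sum_add_distrib, Finset.sum_add_distrib]
  congr 1
  · have := Finset.sum_card_bipartiteAbove_eq_sum_card_bipartiteBelow
      (s := S) (t := univ.filter (fun g : G => g ∉ Z)) (fun P g => g • P = P)
    simp only [bipartiteAbove, bipartiteBelow, filter_filter] at this
    simpa only [fixers] using this
  · have := Finset.sum_card_bipartiteAbove_eq_sum_card_bipartiteBelow
      (s := S) (t := univ.filter (fun g : G => g ∉ Z)) (fun P g => fixedBy X g = {P})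
    simp only [bipartiteAbove, bipartiteBelow, filter_filter] at this
    simpa only [soleFixers] using this

lemma sum_card_le (hF : ∀ g ∉ Z, ∃ a b : X, fixedBy X g = {a, b}) (S : Finset X) :
    ∑ P ∈ S, ((fixers Z P).card + (soleFixers Z P).card) + 2 * Nat.card Z ≤ 2 * Nat.card G := by
  classical
  rw [sum_card_eq, ← card_compl Z]
  have : ∑ g ∈ univ.filter (fun g : G => g ∉ Z),
        ((S.filter (fun P => g • P = P)).card +
          (S.filter (fun P => fixedBy X g = {P})).card) ≤
      ∑ g ∈ univ.filter (fun g : G => g ∉ Z), 2 := by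
    apply Finset.sum_le_sum
    intro g hg
    obtain ⟨a, b, hab⟩ := hF g (by simpa using hg)
    exact (card_fixed_add_card_sole_le S hab).1
  rw [Finset.sum_const, smul_eq_mul] at this
  linarith

lemma sum_card_of_forall_mem (hF : ∀ g ∉ Z, ∃ a b : X, fixedBy X g = {a, b}) (S : Finset X)
    (hS : ∀ g ∉ Z, ∀ P : X, g • P = P → P ∈ S) :
    ∑ P ∈ S, ((fixers Z P).card + (soleFixers Z P).card) + 2 * Nat.card Z = 2 * Nat.card G := by
  classical
  rw [sum_card_eq, ← card_compl Z]
  have : ∑ g ∈ univ.filter (fun g : G => g ∉ Z),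
        ((S.filter (fun P => g • P = P)).card +
          (S.filter (fun P => fixedBy X g = {P})).card) =
      ∑ g ∈ univ.filter (fun g : G => g ∉ Z), 2 := by
    apply Finset.sum_congr rfl
    intro g hg
    have hg : g ∉ Z := by simpa using hg
    obtain ⟨a, b, hab⟩ := hF g hg
    have ha : a ∈ fixedBy X g := hab ▸ Set.mem_insert a {b}
    have hb : b ∈ fixedBy X g := hab ▸ Set.mem_insert_of_mem a rfl
    exact (card_fixed_add_card_sole_le S hab).2 (hS g hg a ha) (hS g hg b hb)
  rw [Finset.sum_const, smul_eq_mul] at this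
  linarith

lemma card_soleFixers_smul [Z.Normal] (h : G) (P : X) :
    (soleFixers Z (h • P)).card = (soleFixers Z P).card := by
  classical
  symm
  refine Finset.card_equiv (MulAut.conj h).toEquiv fun g => ?_
  have e : (MulAut.conj h).toEquiv g = h * g * h⁻¹ := rfl
  have key : ∀ x : X, x ∈ fixedBy X (h * g * h⁻¹) ↔ h⁻¹ • x ∈ fixedBy X g := by
    intro x
    simp only [mem_fixedBy, mul_smul]
    rw [← eq_inv_smul_iff]
  have hz : h * g * h⁻¹ ∈ Z ↔ g ∈ Z := by
    constructor
    · intro hh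
      have := Subgroup.Normal.conj_mem inferInstance _ hh h⁻¹
      simpa [mul_assoc] using this
    · exact fun hh => Subgroup.Normal.conj_mem inferInstance _ hh h
  rw [e]
  simp only [soleFixers, mem_filter, mem_univ, true_and, hz]
  refine and_congr_right fun _ => ?_
  simp only [Set.ext_iff, key, Set.mem_singleton_iff]
  constructor
  · intro H x
    rw [H (h⁻¹ • x), inv_smul_eq_iff]
  · intro H x
    have := H (h • x)
    rw [inv_smul_smul] at this
    rw [this]
    exact smul_left_cancel_iff h

lemma finite_orbit' (P : X) : (orbit G P).Finite := Set.finite_range _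

/-- Both counts are constant along an orbit, because stabilizers are conjugate. The orbit–stabilizer
theorem does the rest; the term |orbit|·|Z| is moved to the left to avoid subtraction. -/
lemma sum_orbit [Z.Normal] (hZ : ∀ g ∈ Z, ∀ x : X, g • x = x) (P : X) :
    ∑ R ∈ (finite_orbit' (G := G) P).toFinset, ((fixers Z R).card + (soleFixers Z R).card)
      + Nat.card (orbit G P) * Nat.card Z =
      Nat.card G + Nat.card (orbit G P) * (soleFixers Z P).card := by
  have hc : (finite_orbit' (G := G) P).toFinset.card = Nat.card (orbit G P) := by
    rw [Nat.card_coe_set_eq, Set.ncard_eq_toFinset_card _ (finite_orbit' P)]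
  have h : ∀ R ∈ (finite_orbit' (G := G) P).toFinset,
      (fixers Z R).card + (soleFixers Z R).card = (fixers Z P).card + (soleFixers Z P).card := by
    intro R hR
    rw [Set.Finite.mem_toFinset] at hR
    have ho : orbit G R = orbit G P := orbit_eq_iff.2 hR
    have h1 := card_orbit_mul_card_stabilizer (G := G) R
    have h2 := card_orbit_mul_card_stabilizer (G := G) P
    rw [ho, ← h2] at h1
    have hpos : 0 < Nat.card (orbit G P) := by
      have := (finite_orbit' (G := G) P).to_subtype
      have : Nonempty (orbit G P) := ⟨⟨P, mem_orbit_self P⟩⟩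
      exact Nat.card_pos
    have h3 := Nat.eq_of_mul_eq_mul_left hpos h1
    rw [← card_fixers hZ, ← card_fixers hZ] at h3
    obtain ⟨k, rfl⟩ := hR
    rw [show (fun m : G => m • P) k = k • P from rfl] at *
    rw [card_soleFixers_smul]
    omega
  rw [Finset.sum_congr rfl h, Finset.sum_const, smul_eq_mul, hc,
    ← card_orbit_mul_card_stabilizer (G := G) P, ← card_fixers hZ]
  ring

lemma disjoint_orbit_toFinset {P Q : X} (h : orbit G P ≠ orbit G Q) :
    Disjoint (finite_orbit' (G := G) P).toFinset (finite_orbit' (G := G) Q).toFinset := by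
  rw [Set.Finite.disjoint_toFinset]
  exact (orbit.eq_or_disjoint P Q).resolve_left h

/-- Orbits with stabilizers of order at least 4|Z|, 4|Z| and 2|Z| contribute at least 3/4 + 3/4 +
1/2 = 2 times |G|. The total weight is only 2|G| - 2|Z|, so a third orbit with a noncentral
stabilizer is impossible. -/
lemma orbit_eq_or_orbit_eq [Z.Normal] (hZ : ∀ g ∈ Z, ∀ x : X, g • x = x)
    (hF : ∀ g ∉ Z, ∃ a b : X, fixedBy X g = {a, b}) {P Q : X}
    (hP : 4 * Nat.card Z ≤ Nat.card (stabilizer G P))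
    (hQ : 4 * Nat.card Z ≤ Nat.card (stabilizer G Q)) (hPQ : orbit G P ≠ orbit G Q)
    {g : G} (hg : g ∉ Z) {R : X} (hR : g • R = R) :
    orbit G R = orbit G P ∨ orbit G R = orbit G Q := by
  classical
  by_contra! H
  have hle : Z ≤ stabilizer G R := fun z hz => hZ z hz R
  obtain ⟨m, hm⟩ := Subgroup.card_dvd_of_le hle
  have hzpos : 0 < Nat.card Z := Nat.card_pos
  have hm2 : 2 ≤ m := by
    rw [← card_fixers hZ] at hm
    have : 0 < (fixers Z R).card := Finset.card_pos.2 ⟨g, by simp [fixers, hg, hR]⟩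
    by_contra! hlt
    interval_cases m <;> omega
  have hsum := sum_card_le hF ((finite_orbit' (G := G) P).toFinset ∪
    (finite_orbit' (G := G) Q).toFinset ∪ (finite_orbit' (G := G) R).toFinset)
  rw [Finset.sum_union, Finset.sum_union (disjoint_orbit_toFinset hPQ)] at hsum
  · have sP := sum_orbit (Z := Z) hZ P
    have sQ := sum_orbit (Z := Z) hZ Q
    have sR := sum_orbit (Z := Z) hZ R
    have oP := card_orbit_mul_card_stabilizer (G := G) P
    have oQ := card_orbit_mul_card_stabilizer (G := G) Q
    have oR := card_orbit_mul_card_stabilizer (G := G) R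
    have iP := Nat.mul_le_mul_left (Nat.card (orbit G P)) hP
    have iQ := Nat.mul_le_mul_left (Nat.card (orbit G Q)) hQ
    have iR := Nat.mul_le_mul_left (Nat.card (orbit G R)) (Nat.mul_le_mul_left (Nat.card Z) hm2)
    rw [← hm, oR] at iR
    rw [oP] at iP
    rw [oQ] at iQ
    nlinarith [Nat.zero_le (Nat.card (orbit G P) * (soleFixers Z P).card),
      Nat.zero_le (Nat.card (orbit G Q) * (soleFixers Z Q).card),
      Nat.zero_le (Nat.card (orbit G R) * (soleFixers Z R).card)]
  · rw [Finset.disjoint_union_left]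
    exact ⟨disjoint_orbit_toFinset H.1.symm, disjoint_orbit_toFinset H.2.symm⟩

/-- As no third orbit carries fixed points, the weight inequality is an equality on the union of the
two orbits. -/
theorem card_orbit_mul_card_soleFixers [Z.Normal] (hZ : ∀ g ∈ Z, ∀ x : X, g • x = x)
    (hF : ∀ g ∉ Z, ∃ a b : X, fixedBy X g = {a, b}) {P Q : X}
    (hP : 4 * Nat.card Z ≤ Nat.card (stabilizer G P))
    (hQ : 4 * Nat.card Z ≤ Nat.card (stabilizer G Q)) (hPQ : orbit G P ≠ orbit G Q) :
    Nat.card (orbit G P) * (soleFixers Z P).card + Nat.card (orbit G Q) * (soleFixers Z Q).card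
      + 2 * Nat.card Z = (Nat.card (orbit G P) + Nat.card (orbit G Q)) * Nat.card Z := by
  classical
  have hsum := sum_card_of_forall_mem hF ((finite_orbit' (G := G) P).toFinset ∪
    (finite_orbit' (G := G) Q).toFinset) (by
      intro g hg R hR
      rw [Finset.mem_union, Set.Finite.mem_toFinset, Set.Finite.mem_toFinset]
      exact (orbit_eq_or_orbit_eq hZ hF hP hQ hPQ hg hR).imp orbit_eq_iff.1 orbit_eq_iff.1)
  rw [Finset.sum_union (disjoint_orbit_toFinset hPQ)] at hsum
  have sP := sum_orbit (Z := Z) hZ P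
  have sQ := sum_orbit (Z := Z) hZ Q
  nlinarith

end OrbitCounting

/-! ### Möbius action on the projective line over an extension field. -/

section ProjectiveLine

open MulAction OnePoint

variable {F : Type*} [Field F]

lemma eq_one_or_eq_neg_one_of_sq_eq_one {a : F} (h : a ^ 2 = 1) : a = 1 ∨ a = -1 := by
  rwa [sq, mul_self_eq_one_iff] at h

lemma mem_center_iff_eq (g : SL(2, F)) :
    g ∈ Subgroup.center SL(2, F) ↔ g = 1 ∨ g = -1 := by
  rw [Matrix.SpecialLinearGroup.mem_center_iff]
  constructor
  · rintro ⟨r, hr, h⟩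
    simp only [Fintype.card_fin] at hr
    have h00 : g 0 0 = r := by rw [← h]; simp
    have h01 : g 0 1 = 0 := by rw [← h]; simp
    have h10 : g 1 0 = 0 := by rw [← h]; simp
    have h11 : g 1 1 = r := by rw [← h]; simp
    rcases eq_one_or_eq_neg_one_of_sq_eq_one hr with e | e
    · exact Or.inl (ext_entries (by simp [*]) (by simp [*]) (by simp [*]) (by simp [*]))
    · exact Or.inr (ext_entries (by simp [*]) (by simp [*]) (by simp [*]) (by simp [*]))
  · rintro (rfl | rfl)
    · exact ⟨1, by simp, by simp⟩
    · refine ⟨-1, by simp, ?_⟩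
      ext i j; fin_cases i <;> fin_cases j <;> simp

lemma center_le_iff {H : Subgroup SL(2, F)} :
    Subgroup.center SL(2, F) ≤ H ↔ (-1 : SL(2, F)) ∈ H := by
  constructor
  · exact fun h => h ((mem_center_iff_eq _).2 (Or.inr rfl))
  · intro h g hg
    rcases (mem_center_iff_eq g).1 hg with rfl | rfl
    · exact H.one_mem
    · exact h

lemma card_center_dvd_two : Nat.card (Subgroup.center SL(2, F)) ∣ 2 := by
  have : Subgroup.center SL(2, F) = Subgroup.zpowers (-1) := by
    apply le_antisymm
    · rw [center_le_iff]; exact Subgroup.mem_zpowers _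
    · rw [Subgroup.zpowers_le, mem_center_iff_eq]; exact Or.inr rfl
  rw [this, Nat.card_zpowers]
  exact orderOf_dvd_of_pow_eq_one (by simp)

variable {K : Type*} [Field K] [DecidableEq K] [Algebra F K]

/-- Möbius action of `SL(2, F)` on the projective line over an extension `K` of `F`. -/
noncomputable instance mobiusAction : MulAction SL(2, F) (OnePoint K) :=
  MulAction.compHom (OnePoint K)
    ((Matrix.SpecialLinearGroup.toGL (n := Fin 2) (R := K)).comp
      (Matrix.SpecialLinearGroup.map (n := Fin 2) (algebraMap F K)))

local notation "α" => algebraMap F K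

lemma smul_infty_ite (g : SL(2, F)) :
    g • (∞ : OnePoint K) = if α (g 1 0) = 0 then ∞ else ((α (g 0 0) / α (g 1 0) : K) : OnePoint K) := by
  exact OnePoint.smul_infty_eq_ite _

lemma smul_coe_ite (g : SL(2, F)) (k : K) :
    g • (k : OnePoint K) = if α (g 1 0) * k + α (g 1 1) = 0 then ∞ else
      (((α (g 0 0) * k + α (g 0 1)) / (α (g 1 0) * k + α (g 1 1)) : K) : OnePoint K) := by
  exact OnePoint.smul_some_eq_ite

lemma smul_infty_eq_infty_iff (g : SL(2, F)) : g • (∞ : OnePoint K) = ∞ ↔ g 1 0 = 0 := by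
  rw [smul_infty_ite]; simp

lemma smul_infty_of_ne {g : SL(2, F)} (h : g 1 0 ≠ 0) :
    g • (∞ : OnePoint K) = ((α (g 0 0 / g 1 0) : K) : OnePoint K) := by
  rw [smul_infty_ite, if_neg (by simpa using h), map_div₀]

lemma smul_coe_eq_self_iff (g : SL(2, F)) (k : K) :
    g • (k : OnePoint K) = k ↔ α (g 1 0) * k ^ 2 + (α (g 1 1) - α (g 0 0)) * k - α (g 0 1) = 0 := by
  have hd : α (g 0 0) * α (g 1 1) - α (g 0 1) * α (g 1 0) = 1 := by
    rw [← map_mul, ← map_mul, ← map_sub, det_eq_one, map_one]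
  rw [smul_coe_ite]
  split_ifs with h
  · constructor
    · intro e; exact absurd e (infty_ne_coe _)
    · intro e
      exfalso
      have h2 : α (g 0 0) * k + α (g 0 1) = 0 := by linear_combination k * h - e
      exact (one_ne_zero : (1 : K) ≠ 0) (by
        linear_combination -hd + (α (g 0 0)) * h - (α (g 1 0)) * h2)
  · rw [coe_eq_coe, div_eq_iff h]
    constructor
    · intro e; linear_combination -e
    · intro e; linear_combination -e

lemma smul_of_mem_center {g : SL(2, F)} (hg : g ∈ Subgroup.center SL(2, F)) (P : OnePoint K) :
    g • P = P := by
  induction P using OnePoint.rec with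
  | infty => rw [smul_infty_eq_infty_iff]; rcases (mem_center_iff_eq g).1 hg with rfl | rfl <;> simp
  | coe k => rw [smul_coe_eq_self_iff]; rcases (mem_center_iff_eq g).1 hg with rfl | rfl <;> simp

lemma exists_fixedBy_eq_pair [IsAlgClosed K] {g : SL(2, F)} (hg : g ∉ Subgroup.center SL(2, F)) :
    ∃ P Q : OnePoint K, fixedBy (OnePoint K) g = {P, Q} := by
  have hd := det_eq_one g
  by_cases hc : g 1 0 = 0
  · by_cases had : g 0 0 = g 1 1
    · refine ⟨∞, ∞, ?_⟩
      ext P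
      induction P using OnePoint.rec with
      | infty => simp [smul_infty_eq_infty_iff, hc]
      | coe k =>
        simp only [mem_fixedBy, smul_coe_eq_self_iff, hc, had]
        simp
        intro hb
        apply hg
        rw [mem_center_iff_eq]
        rw [hc, had] at hd
        rcases eq_one_or_eq_neg_one_of_sq_eq_one (show g 1 1 ^ 2 = 1 by linear_combination hd) with e | e
        · exact Or.inl (ext_entries (by simp [*]) (by simp [*]) (by simp [*]) (by simp [*]))
        · exact Or.inr (ext_entries (by simp [*]) (by simp [*]) (by simp [*]) (by simp [*]))
    · refine ⟨∞, ((α (g 0 1 / (g 1 1 - g 0 0)) : K) : OnePoint K), ?_⟩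
      have h0 : α (g 1 1) - α (g 0 0) ≠ 0 := by
        rw [← map_sub]; simpa [sub_eq_zero] using fun e => had e.symm
      ext P
      induction P using OnePoint.rec with
      | infty => simp [smul_infty_eq_infty_iff, hc]
      | coe k =>
        simp only [mem_fixedBy, smul_coe_eq_self_iff, hc]
        simp
        rw [eq_div_iff h0]
        constructor <;> intro e <;> linear_combination e
  · have hc' : α (g 1 0) ≠ 0 := by simpa using hc
    obtain ⟨k, hk⟩ := IsAlgClosed.exists_eval₂_eq_zero (RingHom.id K)
      (Polynomial.C (α (g 1 0)) * Polynomial.X ^ 2 +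
        Polynomial.C (α (g 1 1) - α (g 0 0)) * Polynomial.X + Polynomial.C (- α (g 0 1))) (by
        rw [Polynomial.degree_quadratic hc']; decide)
    simp at hk
    -- The second fixed point is the other root of the quadratic, by Vieta.
    refine ⟨(k : OnePoint K), (((α (g 0 0) - α (g 1 1)) / α (g 1 0) - k : K) : OnePoint K), ?_⟩
    ext P
    induction P using OnePoint.rec with
    | infty => simp [smul_infty_eq_infty_iff, hc]
    | coe m =>
      simp only [mem_fixedBy, smul_coe_eq_self_iff]
      have : α (g 1 0) * m ^ 2 + (α (g 1 1) - α (g 0 0)) * m - α (g 0 1) =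
          α (g 1 0) * ((m - k) * (m - ((α (g 0 0) - α (g 1 1)) / α (g 1 0) - k))) := by
        field_simp
        linear_combination hk
      rw [this]
      simp [hc', sub_eq_zero]

/-- An upper triangular g has a finite fixed point as soon as its diagonal entries differ, so fixing
only ∞ means being ± a nontrivial translation. -/
lemma fixedBy_eq_infty_iff (g : SL(2, F)) : fixedBy (OnePoint K) g = {∞} ↔
    g ∉ Subgroup.center SL(2, F) ∧ g 1 0 = 0 ∧ g 0 0 ^ 2 = 1 := by
  have hd := det_eq_one g
  constructor
  · intro h
    have h1 : (∞ : OnePoint K) ∈ fixedBy (OnePoint K) g := h ▸ rfl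
    have hc : g 1 0 = 0 := (smul_infty_eq_infty_iff (K := K) g).1 h1
    refine ⟨fun hz => ?_, hc, ?_⟩
    · have h2 : ((0 : K) : OnePoint K) ∈ fixedBy (OnePoint K) g := smul_of_mem_center hz _
      rw [h] at h2
      exact absurd h2 (coe_ne_infty _)
    · by_contra hne
      have had : g 1 1 - g 0 0 ≠ 0 := by
        intro e; rw [hc] at hd; apply hne; linear_combination hd - g 0 0 * e
      have h2 : ((α (g 0 1 / (g 1 1 - g 0 0)) : K) : OnePoint K) ∈ fixedBy (OnePoint K) g := by
        rw [mem_fixedBy, smul_coe_eq_self_iff, hc, ← map_sub, map_zero, zero_mul, zero_add,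
          ← map_mul, ← map_sub, mul_div_cancel₀ _ had, sub_self, map_zero]
      rw [h] at h2
      exact absurd h2 (coe_ne_infty _)
  · rintro ⟨hz, hc, ha⟩
    have h0 : g 0 0 ≠ 0 := by intro e; simp [e] at ha
    have had : g 1 1 = g 0 0 := by
      rw [hc] at hd
      exact mul_left_cancel₀ h0 (by linear_combination hd - ha)
    have hb : g 0 1 ≠ 0 := by
      intro hb
      apply hz
      rw [mem_center_iff_eq]
      rcases eq_one_or_eq_neg_one_of_sq_eq_one ha with e | e
      · exact Or.inl (ext_entries (by simp [*]) (by simp [*]) (by simp [*]) (by simp [*]))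
      · exact Or.inr (ext_entries (by simp [*]) (by simp [*]) (by simp [*]) (by simp [*]))
    ext P
    induction P using OnePoint.rec with
    | infty => simp [smul_infty_eq_infty_iff, hc]
    | coe k => simp [smul_coe_eq_self_iff, hc, had, hb]

/-- An element with a single fixed point on the projective line over `K` fixes an `F`-point. -/
lemma exists_fixedBy_eq_coe_algebraMap {g : SL(2, F)} {k : K} [IsAlgClosed K]
    (h : fixedBy (OnePoint K) g = {(k : OnePoint K)}) : ∃ s : F, α s = k := by
  have hd := det_eq_one g
  have hk : α (g 1 0) * k ^ 2 + (α (g 1 1) - α (g 0 0)) * k - α (g 0 1) = 0 := by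
    rw [← smul_coe_eq_self_iff]
    exact (h ▸ rfl : (k : OnePoint K) ∈ fixedBy (OnePoint K) g)
  have hc : g 1 0 ≠ 0 := by
    intro e
    have : (∞ : OnePoint K) ∈ fixedBy (OnePoint K) g := (smul_infty_eq_infty_iff (K := K) g).2 e
    rw [h] at this
    exact absurd this (infty_ne_coe _)
  have hc' : α (g 1 0) ≠ 0 := by simpa using hc
  have h2 : ((((α (g 0 0) - α (g 1 1)) / α (g 1 0) - k : K)) : OnePoint K)
      ∈ fixedBy (OnePoint K) g := by
    rw [mem_fixedBy, smul_coe_eq_self_iff]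
    field_simp
    linear_combination α (g 1 0) * hk
  rw [h, Set.mem_singleton_iff, coe_eq_coe] at h2
  have h3 : 2 * α (g 1 0) * k = α (g 0 0) - α (g 1 1) := by
    field_simp at h2
    linear_combination -h2
  -- A double root makes the discriminant tr² - 4 vanish. Solving `h3` for k would fail in
  -- characteristic 2, so k is obtained as (a - ε)/c from the eigenvalue ε = ±1.
  have h4 : α ((g 0 0 + g 1 1) ^ 2 - 2 ^ 2) = 0 := by
    have hd' := congrArg (algebraMap F K) hd
    simp only [map_sub, map_mul, map_one, map_pow, map_add, map_ofNat] at hd' ⊢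
    linear_combination 4 * hd' + (-4 * α (g 1 0)) * hk + (2 * α (g 1 0) * k +
      (α (g 1 1) - α (g 0 0))) * h3
  have h5 : (g 0 0 + g 1 1) ^ 2 = 2 ^ 2 := by
    have := (algebraMap F K).injective (h4.trans (map_zero _).symm)
    linear_combination this
  have key : ∀ ε : F, ε ^ 2 = 1 → g 0 0 + g 1 1 = 2 * ε → ∃ s : F, α s = k := by
    intro ε he ht
    refine ⟨(g 0 0 - ε) / g 1 0, ?_⟩
    have : ((α ((g 0 0 - ε) / g 1 0) : K) : OnePoint K) ∈ fixedBy (OnePoint K) g := by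
      rw [mem_fixedBy, smul_coe_eq_self_iff, ← map_sub, ← map_pow, ← map_mul, ← map_mul,
        ← map_add, ← map_sub, map_eq_zero]
      field_simp
      linear_combination hd - he - ε * ht
    rw [h, Set.mem_singleton_iff, coe_eq_coe] at this
    exact this
  rcases sq_eq_sq_iff_eq_or_eq_neg.1 h5 with e | e
  · exact key 1 (by simp) (by simpa using e)
  · exact key (-1) (by simp) (by simpa using e)

end ProjectiveLine

/-! ### The upper triangular subgroup of H: translations, dilations and the orbit of ∞. -/

section Borel

open MulAction OnePoint

variable {F : Type*} [Field F]

/-- Upper unitriangular elements of `SL(2, F)`. -/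
def upper (t : F) : SL(2, F) := mk 1 t 0 1 (by ring)

/-- Lower unitriangular elements of `SL(2, F)`. -/
def lower (t : F) : SL(2, F) := mk 1 0 t 1 (by ring)

lemma upper_add (s t : F) : upper (s + t) = upper s * upper t := by
  apply ext_entries <;> simp only [upper, mul_00, mul_01, mul_10, mul_11, mk_00, mk_01, mk_10,
    mk_11] <;> ring

lemma upper_zero : upper (0 : F) = 1 := by
  apply ext_entries <;> simp [upper]

lemma upper_neg (t : F) : upper (-t) = (upper t)⁻¹ := by
  rw [eq_inv_iff_mul_eq_one, ← upper_add, neg_add_cancel, upper_zero]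

variable (H : Subgroup SL(2, F))

/-- The additive group of all `t` such that `H` contains the translation by `t`. -/
def translations : AddSubgroup F where
  carrier := {t | upper t ∈ H}
  add_mem' {s t} hs ht := by
    simp only [Set.mem_ofPred_eq] at *
    rw [upper_add]; exact H.mul_mem hs ht
  zero_mem' := by
    simp only [Set.mem_ofPred_eq]
    rw [upper_zero]; exact H.one_mem
  neg_mem' {t} ht := by
    simp only [Set.mem_ofPred_eq] at *
    rw [upper_neg]; exact H.inv_mem ht

/-- The upper triangular elements of `H`. -/
def borel : Subgroup SL(2, F) where
  carrier := {g | g ∈ H ∧ g 1 0 = 0}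
  mul_mem' {g h} hg hh := ⟨H.mul_mem hg.1 hh.1, by rw [mul_10, hg.2, hh.2]; ring⟩
  one_mem' := ⟨H.one_mem, rfl⟩
  inv_mem' {g} hg := ⟨H.inv_mem hg.1, by rw [inv_10, hg.2, neg_zero]⟩

variable {H} in
lemma borel_diag (g : borel H) : g.1 0 0 * g.1 1 1 = 1 := by
  have h1 := det_eq_one g.1
  rw [g.2.2, mul_zero, sub_zero] at h1
  exact h1

/-- The multiplier of an upper triangular Möbius transformation. -/
def multiplier : borel H →* Fˣ where
  toFun g := ⟨g.1 0 0 ^ 2, g.1 1 1 ^ 2, by rw [← mul_pow, borel_diag, one_pow],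
    by rw [← mul_pow, mul_comm, borel_diag, one_pow]⟩
  map_one' := by ext; simp
  map_mul' g h := by
    ext
    simp only [Units.val_mul, Subgroup.coe_mul, mul_00, h.2.2]
    ring

/-- The group of multipliers of the upper triangular elements of `H`. -/
def dilations : Subgroup Fˣ := (multiplier H).range

variable {H}

lemma mem_dilations {u : Fˣ} : u ∈ dilations H ↔ ∃ g ∈ H, g 1 0 = 0 ∧ g 0 0 ^ 2 = u := by
  constructor
  · rintro ⟨g, rfl⟩
    exact ⟨g.1, g.2.1, g.2.2, rfl⟩
  · rintro ⟨g, hg, hc, hu⟩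
    exact ⟨⟨g, hg, hc⟩, Units.ext hu⟩

lemma mul_mem_translations {u : Fˣ} (hu : u ∈ dilations H) {t : F} (ht : t ∈ translations H) :
    (u : F) * t ∈ translations H := by
  obtain ⟨g, hg, hc, hu⟩ := mem_dilations.1 hu
  have hd := det_eq_one g
  rw [hc, mul_zero, sub_zero] at hd
  have : upper ((u : F) * t) = g * upper t * g⁻¹ := by
    apply ext_entries <;> simp only [upper, mul_00, mul_01, mul_10, mul_11, mk_00, mk_01, mk_10,
      mk_11, inv_00, inv_01, inv_10, inv_11, hc, ← hu]
    · linear_combination -hd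
    · ring
    · ring
    · linear_combination -hd
  change upper _ ∈ H
  rw [this]
  exact H.mul_mem (H.mul_mem hg ht) (H.inv_mem hg)

lemma card_dvd_ncard_of_add_mem {A : Type*} [AddGroup A] (T : AddSubgroup A) (S : Set A)
    (h : ∀ s ∈ S, ∀ t ∈ T, s + t ∈ S) : Nat.card T ∣ S.ncard := by
  have : S = (QuotientAddGroup.mk : A → A ⧸ T) ⁻¹' ((QuotientAddGroup.mk : A → A ⧸ T) '' S) := by
    ext x
    constructor
    · exact fun hx => ⟨x, hx, rfl⟩
    · rintro ⟨s, hs, e⟩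
      have := h s hs _ (QuotientAddGroup.eq.1 e)
      rwa [add_neg_cancel_left] at this
  rw [this, ← Nat.card_coe_set_eq,
    Nat.card_congr (QuotientAddGroup.preimageMkEquivAddSubgroupProdSet T _), Nat.card_prod]
  exact dvd_mul_right _ _

lemma card_dvd_ncard_of_mul_mem {A : Type*} [Group A] (T : Subgroup A) (S : Set A)
    (h : ∀ s ∈ S, ∀ t ∈ T, s * t ∈ S) : Nat.card T ∣ S.ncard := by
  have : S = (QuotientGroup.mk : A → A ⧸ T) ⁻¹' ((QuotientGroup.mk : A → A ⧸ T) '' S) := by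
    ext x
    constructor
    · exact fun hx => ⟨x, hx, rfl⟩
    · rintro ⟨s, hs, e⟩
      have := h s hs _ (QuotientGroup.eq.1 e)
      rwa [mul_inv_cancel_left] at this
  rw [this, ← Nat.card_coe_set_eq,
    Nat.card_congr (QuotientGroup.preimageMkEquivSubgroupProdSet T _), Nat.card_prod]
  exact dvd_mul_right _ _

/-- Dilations act freely by multiplication on the nonzero translations, so these form a union of
cosets of the dilation group. -/
lemma card_dilations_dvd [Finite F] :
    Nat.card (dilations H) ∣ Nat.card (translations H) - 1 := by
  have h1 : {u : Fˣ | (u : F) ∈ translations H}.ncard + 1 = Nat.card (translations H) := by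
    have : ((translations H : Set F)) =
        insert 0 ((fun u : Fˣ => (u : F)) '' {u : Fˣ | (u : F) ∈ translations H}) := by
      ext t
      simp only [SetLike.mem_coe, Set.mem_insert_iff, Set.mem_image, Set.mem_ofPred_eq]
      constructor
      · intro ht
        by_cases h0 : t = 0
        · exact Or.inl h0
        · exact Or.inr ⟨Units.mk0 t h0, ht, rfl⟩
      · rintro (rfl | ⟨u, hu, rfl⟩)
        · exact (translations H).zero_mem
        · exact hu
    rw [show Nat.card (translations H) = (translations H : Set F).ncard from
      Nat.card_coe_set_eq _, this, Set.ncard_insert_of_notMem _ (Set.toFinite _),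
      Set.ncard_image_of_injective _ Units.val_injective]
    rintro ⟨u, -, hu⟩
    exact u.ne_zero hu
  rw [← h1, Nat.add_sub_cancel]
  apply card_dvd_ncard_of_mul_mem
  intro u hu v hv
  simp only [Set.mem_ofPred_eq] at *
  rw [Units.val_mul, mul_comm]
  exact mul_mem_translations hv hu

/-- Each such element is uniquely a central element times a translation. The order of the centre is
kept as a factor since it is 1 in characteristic 2 and 2 otherwise. -/
lemma ncard_unipotent [Finite F] (hH : -1 ∈ H) :
    {g | g ∈ H ∧ g 1 0 = 0 ∧ g 0 0 ^ 2 = 1}.ncard =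
      Nat.card (Subgroup.center SL(2, F)) * Nat.card (translations H) := by
  have : {g | g ∈ H ∧ g 1 0 = 0 ∧ g 0 0 ^ 2 = 1} =
      (fun p : SL(2, F) × F => p.1 * upper p.2) ''
        ((Subgroup.center SL(2, F) : Set SL(2, F)) ×ˢ (translations H : Set F)) := by
    ext g
    simp only [Set.mem_ofPred_eq, Set.mem_image, Set.mem_prod, SetLike.mem_coe, Prod.exists]
    constructor
    · rintro ⟨hg, hc, ha⟩
      have hd := det_eq_one g
      rw [hc, mul_zero, sub_zero] at hd
      have hu : ∀ ζ : SL(2, F), ζ ∈ Subgroup.center SL(2, F) → ζ * upper (g 0 0 * g 0 1) = g →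
          ∃ a b, (a ∈ Subgroup.center SL(2, F) ∧ b ∈ translations H) ∧ a * upper b = g := by
        intro ζ hζ e
        refine ⟨ζ, _, ⟨hζ, ?_⟩, e⟩
        change upper _ ∈ H
        rw [← inv_mul_eq_iff_eq_mul.2 e.symm]
        exact H.mul_mem (H.inv_mem (center_le_iff.2 hH hζ)) hg
      rcases eq_one_or_eq_neg_one_of_sq_eq_one ha with e | e
      · refine hu 1 (Subgroup.one_mem _) ?_
        rw [e, one_mul] at hd
        apply ext_entries <;> simp [upper, e, hc, hd]
      · refine hu (-1) ((mem_center_iff_eq _).2 (Or.inr rfl)) ?_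
        have hd : g 1 1 = -1 := by rw [e] at hd; linear_combination -hd
        apply ext_entries <;> simp [upper, e, hc, hd]
    · rintro ⟨ζ, t, ⟨hζ, ht⟩, rfl⟩
      refine ⟨H.mul_mem (center_le_iff.2 hH hζ) ht, ?_⟩
      rcases (mem_center_iff_eq _).1 hζ with rfl | rfl <;> simp [upper]
  rw [this, Set.InjOn.ncard_image, Set.ncard_prod, ← Nat.card_coe_set_eq,
    ← Nat.card_coe_set_eq]
  · rfl
  · rintro ⟨ζ, t⟩ ⟨hζ, -⟩ ⟨ξ, s⟩ ⟨hξ, -⟩ e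
    simp only [SetLike.mem_coe] at hζ hξ e
    have h00 : (ζ * upper t) 0 0 = (ξ * upper s) 0 0 := by rw [e]
    have hζξ : ζ = ξ := by
      rcases (mem_center_iff_eq _).1 hζ with rfl | rfl <;>
      rcases (mem_center_iff_eq _).1 hξ with rfl | rfl <;>
      simp only [one_mul, upper, mk_00, neg_mul, neg_00] at h00 <;>
      first
        | rfl
        | (apply ext_entries <;> simp <;> grind)
    rw [hζξ] at e ⊢
    have h01 : (upper t) 0 1 = (upper s) 0 1 := by rw [mul_left_cancel e]
    exact congrArg _ h01

lemma card_borel [Finite F] (hH : -1 ∈ H) :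
    Nat.card (borel H) = Nat.card (Subgroup.center SL(2, F)) * Nat.card (translations H) *
      Nat.card (dilations H) := by
  rw [← ncard_unipotent hH, ← Subgroup.card_mul_index (multiplier H).ker, Subgroup.index_ker]
  congr 1
  have : {g | g ∈ H ∧ g 1 0 = 0 ∧ g 0 0 ^ 2 = 1} =
      (Subtype.val : borel H → SL(2, F)) '' ((multiplier H).ker : Set (borel H)) := by
    ext g
    simp only [Set.mem_ofPred_eq, Set.mem_image, SetLike.mem_coe, MonoidHom.mem_ker]
    constructor
    · rintro ⟨hg, hc, ha⟩
      exact ⟨⟨g, hg, hc⟩, Units.ext ha, rfl⟩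
    · rintro ⟨g, hg, rfl⟩
      exact ⟨g.2.1, g.2.2, congrArg Units.val hg⟩
  rw [this, Set.ncard_image_of_injective _ Subtype.val_injective, ← Nat.card_coe_set_eq]
  rfl

variable {K : Type*} [Field K] [DecidableEq K] [Algebra F K]

lemma card_stabilizer_infty : Nat.card (stabilizer H (∞ : OnePoint K)) = Nat.card (borel H) := by
  have : stabilizer H (∞ : OnePoint K) = (borel H).subgroupOf H := by
    ext g
    rw [mem_stabilizer_iff, Subgroup.mem_subgroupOf]
    exact (smul_infty_eq_infty_iff (K := K) g.1).trans ⟨fun h => ⟨g.2, h⟩, fun h => h.2⟩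
  rw [this]
  exact Nat.card_congr (Subgroup.subgroupOfEquivOfLe (show borel H ≤ H from fun g hg => hg.1)).toEquiv

lemma card_center_subgroupOf (hH : -1 ∈ H) : Nat.card ((Subgroup.center SL(2, F)).subgroupOf H) =
    Nat.card (Subgroup.center SL(2, F)) :=
  Nat.card_congr (Subgroup.subgroupOfEquivOfLe (center_le_iff.2 hH)).toEquiv

lemma card_soleFixers_infty [Finite F] [Fintype H] (hH : -1 ∈ H) :
    (soleFixers ((Subgroup.center SL(2, F)).subgroupOf H) (∞ : OnePoint K)).card +
      Nat.card (Subgroup.center SL(2, F)) =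
      Nat.card (Subgroup.center SL(2, F)) * Nat.card (translations H) := by
  classical
  rw [← ncard_unipotent hH]
  have h1 : {g | g ∈ H ∧ g 1 0 = 0 ∧ g 0 0 ^ 2 = 1} =
      (Subtype.val '' (soleFixers ((Subgroup.center SL(2, F)).subgroupOf H) (∞ : OnePoint K) :
        Set H)) ∪ (Subgroup.center SL(2, F) : Set SL(2, F)) := by
    ext g
    have key : ∀ hg : g ∈ H, ((⟨g, hg⟩ : H) ∈ soleFixers ((Subgroup.center SL(2, F)).subgroupOf H)
        (∞ : OnePoint K)) ↔ g ∉ Subgroup.center SL(2, F) ∧ g 1 0 = 0 ∧ g 0 0 ^ 2 = 1 := by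
      intro hg
      rw [soleFixers, Finset.mem_filter, Subgroup.mem_subgroupOf]
      have : fixedBy (OnePoint K) (⟨g, hg⟩ : H) = fixedBy (OnePoint K) g := rfl
      rw [this, fixedBy_eq_infty_iff]
      simp
    simp only [Set.mem_ofPred_eq, Set.mem_union, Set.mem_image, SetLike.mem_coe]
    constructor
    · rintro ⟨hg, hh⟩
      by_cases hz : g ∈ Subgroup.center SL(2, F)
      · exact Or.inr hz
      · exact Or.inl ⟨⟨g, hg⟩, (key hg).2 ⟨hz, hh⟩, rfl⟩
    · rintro (⟨h, hh, rfl⟩ | hz)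
      · exact ⟨h.2, ((key h.2).1 hh).2⟩
      · refine ⟨center_le_iff.2 hH hz, ?_⟩
        rcases (mem_center_iff_eq _).1 hz with rfl | rfl <;> simp
  rw [h1, Set.ncard_union_eq _ (Set.toFinite _) (Set.toFinite _),
    Set.ncard_image_of_injective _ Subtype.val_injective, Set.ncard_coe_finset,
    ← Nat.card_coe_set_eq]
  · rfl
  · rw [Set.disjoint_left]
    rintro _ ⟨h, hh, rfl⟩ hz
    simp only [soleFixers, Finset.coe_filter, Set.mem_ofPred_eq, Subgroup.mem_subgroupOf] at hh
    exact hh.2.1 hz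

variable (H K) in
/-- The affine `F`-points in the orbit of `∞`. -/
def affineOrbit : Set F := {s | ((algebraMap F K s : K) : OnePoint K) ∈ orbit H (∞ : OnePoint K)}

lemma orbit_infty_eq : orbit H (∞ : OnePoint K) =
    insert ∞ ((fun s : F => ((algebraMap F K s : K) : OnePoint K)) '' affineOrbit H K) := by
  ext P
  constructor
  · rintro ⟨g, rfl⟩
    change g.1 • (∞ : OnePoint K) ∈ _
    by_cases hc : g.1 1 0 = 0
    · rw [(smul_infty_eq_infty_iff (K := K) g.1).2 hc]
      exact Set.mem_insert _ _
    · refine Set.mem_insert_of_mem _ ⟨g.1 0 0 / g.1 1 0, ?_, (smul_infty_of_ne hc).symm⟩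
      exact ⟨g, smul_infty_of_ne hc⟩
  · rintro (rfl | ⟨s, hs, rfl⟩)
    · exact mem_orbit_self _
    · exact hs

lemma card_orbit_infty [Finite F] :
    Nat.card (orbit H (∞ : OnePoint K)) = (affineOrbit H K).ncard + 1 := by
  rw [Nat.card_coe_set_eq, orbit_infty_eq, Set.ncard_insert_of_notMem _ (Set.toFinite _),
    Set.ncard_image_of_injective]
  · intro s t e
    exact (algebraMap F K).injective (coe_injective e)
  · rintro ⟨s, -, e⟩
    exact coe_ne_infty _ e

lemma upper_smul (t s : F) : upper t • ((algebraMap F K s : K) : OnePoint K) =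
    ((algebraMap F K (s + t) : K) : OnePoint K) := by
  rw [smul_coe_ite]; simp [upper]

/-- Makes the affine part of the orbit of ∞ a union of cosets of the translation group, whence its
size is a multiple of r = |translations|. -/
lemma add_mem_affineOrbit {s t : F} (hs : s ∈ affineOrbit H K) (ht : t ∈ translations H) :
    s + t ∈ affineOrbit H K := by
  have : ((algebraMap F K (s + t) : K) : OnePoint K) =
      (⟨upper t, ht⟩ : H) • ((algebraMap F K s : K) : OnePoint K) := (upper_smul t s).symm
  change _ ∈ orbit H (∞ : OnePoint K)
  rw [this]
  exact (mem_orbit_iff.1 hs).elim fun g hg => ⟨⟨upper t, ht⟩ * g, by simp only [mul_smul, hg]⟩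

lemma card_translations_dvd : Nat.card (translations H) ∣ (affineOrbit H K).ncard :=
  card_dvd_ncard_of_add_mem _ _ fun _ hs _ ht => add_mem_affineOrbit hs ht

end Borel

/-- Here r and c count translations and dilations, N and M are the orbit sizes of ∞ and of the
irrational point, and e is the stabilizer order of the latter modulo the centre. With s = r - 2, the
fixed-point equation gives M = r(1 + ks); substituting in `h2` shows that 1 + ks divides 2kc, hence
2c. Since c ≤ s + 1, this leaves little room for k. -/
lemma eq_one_and_dvd_of_orbit_equation {r c k e N M : ℕ} (hc : 4 ≤ c) (hcr : c ∣ r - 1)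
    (hr : 1 ≤ r) (hk : 1 ≤ k) (hN : N = r * k + 1) (hM : 1 ≤ M) (h1 : N * r + 2 = 2 * N + M)
    (h2 : M * e = N * (r * c)) : k = 1 ∧ r - 1 ∣ 2 * c := by
  have hr1 : r ≠ 1 := by
    rintro rfl
    omega
  obtain ⟨s, rfl⟩ : ∃ s, r = s + 2 := ⟨r - 2, by omega⟩
  rw [show s + 2 - 1 = s + 1 by omega] at hcr ⊢
  have hcs : c ≤ s + 1 := Nat.le_of_dvd (by omega) hcr
  have hM' : M = (s + 2) * (1 + k * s) := by
    subst hN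
    nlinarith
  have h3 : (1 + k * s) * e = (1 + k * s) * c + k * (2 * c) := by
    rw [hM', hN] at h2
    apply Nat.eq_of_mul_eq_mul_left (show 0 < s + 2 by omega)
    linarith
  have hdvd : 1 + k * s ∣ k * (2 * c) := by
    rw [← Nat.dvd_add_right (dvd_mul_right (1 + k * s) c), ← h3]
    exact dvd_mul_right _ _
  have hcop : Nat.Coprime (1 + k * s) k := by simp
  have hd2 : 1 + k * s ∣ 2 * c := hcop.dvd_of_dvd_mul_left hdvd
  have hle : 1 + k * s ≤ 2 * c := Nat.le_of_dvd (by omega) hd2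
  have hk3 : k < 3 := by
    by_contra! h
    nlinarith
  interval_cases k
  · refine ⟨rfl, ?_⟩
    rwa [one_mul, add_comm] at hd2
  -- For k = 2 the odd number 1 + 2s would divide c, which is at most s + 1.
  · exfalso
    have : Nat.Coprime (1 + 2 * s) 2 := by simp
    have := Nat.le_of_dvd (by omega) (this.dvd_of_dvd_mul_left hd2)
    omega

/-! ### The subfield attached to the translations, and traces of H. -/

section Structure

open MulAction OnePoint

variable {F : Type*} [Field F]

/-- The subfield of all `e` with `e T ⊆ T`. -/
def stabilizingSubfield [Finite F] (T : AddSubgroup F) : Subfield F where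
  carrier := {e | ∀ t ∈ T, e * t ∈ T}
  mul_mem' {a b} ha hb t ht := by rw [mul_assoc]; exact ha _ (hb _ ht)
  one_mem' t ht := by rwa [one_mul]
  add_mem' {a b} ha hb t ht := by rw [add_mul]; exact T.add_mem (ha _ ht) (hb _ ht)
  zero_mem' t ht := by rw [zero_mul]; exact T.zero_mem
  neg_mem' {a} ha t ht := by rw [neg_mul]; exact T.neg_mem (ha _ ht)
  inv_mem' a ha := by
    -- In a finite field the inverse of a is the power a^(q-2), so closure under powers suffices.
    have hpow : ∀ n : ℕ, ∀ t ∈ T, a ^ n * t ∈ T := by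
      intro n
      induction n with
      | zero => intro t ht; simpa using ht
      | succ n ih => intro t ht; rw [pow_succ, mul_assoc]; exact ih _ (ha _ ht)
    have := Fintype.ofFinite F
    by_cases h0 : a = 0
    · subst h0; simp
    · have h1 : a ^ (Fintype.card F - 2) * a = 1 := by
        rw [← pow_succ, show Fintype.card F - 2 + 1 = Fintype.card F - 1 by
          have := Fintype.one_lt_card (α := F); omega]
        exact FiniteField.pow_card_sub_one_eq_one a h0
      rw [← eq_inv_of_mul_eq_one_left h1]
      exact hpow _

/-- The translations T form a vector space over the field E of multipliers preserving T, and E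
contains 0 and all dilations. The divisibility bounds |T| by 2c + 1, too small for dimension two or
more, so T is a line E·t₀. -/
lemma exists_subfield_of_dilations [Finite F] {H : Subgroup SL(2, F)}
    (hr : 1 < Nat.card (translations H))
    (hc : Nat.card (translations H) - 1 ∣ 2 * Nat.card (dilations H)) :
    ∃ (E : Subfield F) (t₀ : F), t₀ ≠ 0 ∧ (∀ u ∈ dilations H, (u : F) ∈ E) ∧
      ∀ t, t ∈ translations H ↔ ∃ e ∈ E, t = e * t₀ := by
  set T := translations H with hT
  obtain ⟨⟨t₀, ht₀⟩, hne⟩ : ∃ t : T, t ≠ 0 := by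
    have := (Finite.one_lt_card_iff_nontrivial (α := T)).1 hr
    exact exists_ne 0
  have h0 : t₀ ≠ 0 := fun h => hne (Subtype.ext h)
  set E := stabilizingSubfield T with hE
  have hΛ : ∀ u ∈ dilations H, (u : F) ∈ E := fun u hu t ht => mul_mem_translations hu ht
  have hle : E.toSubring.toAddSubgroup.map (AddMonoidHom.mulRight t₀) ≤ T := by
    rintro _ ⟨e, he, rfl⟩
    exact he t₀ ht₀
  have hcardE : Nat.card (E.toSubring.toAddSubgroup.map (AddMonoidHom.mulRight t₀)) =
      Nat.card E := by
    refine Nat.card_congr (AddSubgroup.equivMapOfInjective _ (AddMonoidHom.mulRight t₀) ?_).symm.toEquiv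
    intro a b hab
    exact mul_right_cancel₀ h0 hab
  obtain ⟨m, hm⟩ := AddSubgroup.card_dvd_of_le hle
  rw [hcardE] at hm
  have hcE : Nat.card (dilations H) + 1 ≤ Nat.card E := by
    have hsub : insert 0 ((fun u : Fˣ => (u : F)) '' (dilations H : Set Fˣ)) ⊆ (E : Set F) := by
      rintro _ (rfl | ⟨u, hu, rfl⟩)
      · exact E.zero_mem
      · exact hΛ u hu
    have := Set.ncard_le_ncard hsub (Set.toFinite _)
    rw [Set.ncard_insert_of_notMem _ (Set.toFinite _),
      Set.ncard_image_of_injective _ Units.val_injective, ← Nat.card_coe_set_eq,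
      ← Nat.card_coe_set_eq] at this
    · exact this
    · rintro ⟨u, -, hu⟩
      exact u.ne_zero hu
  have hle2 := Nat.le_of_dvd (by have : 0 < Nat.card (dilations H) := Nat.card_pos
                                 omega) hc
  have hm1 : m = 1 := by
    -- Otherwise |T| ≥ 2|E| ≥ 2c + 2, whereas |T| - 1 divides 2c.
    have : m < 2 := by
      by_contra! h
      have := Nat.mul_le_mul_left (Nat.card E) h
      omega
    interval_cases m
    · omega
    · rfl
  have heq := AddSubgroup.eq_of_le_of_card_ge hle (by rw [hcardE, hm, hm1, mul_one])
  refine ⟨E, t₀, h0, hΛ, fun t => ?_⟩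
  rw [← heq]
  constructor
  · rintro ⟨e, he, rfl⟩
    exact ⟨e, he, rfl⟩
  · rintro ⟨e, he, rfl⟩
    exact ⟨e, he, rfl⟩

lemma eq_top_of_upper_of_lower {H : Subgroup SL(2, F)} (hu : ∀ t, upper t ∈ H)
    (hl : ∀ t, lower t ∈ H) : H = ⊤ := by
  have key : ∀ g : SL(2, F), g 1 0 ≠ 0 → g ∈ H := by
    intro g hg
    have hd := det_eq_one g
    have : g = upper ((g 0 0 - 1) / g 1 0) * lower (g 1 0) * upper ((g 1 1 - 1) / g 1 0) := by
      apply ext_entries <;> simp only [upper, lower, mul_00, mul_01, mul_10, mul_11, mk_00, mk_01,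
        mk_10, mk_11] <;> field_simp <;> first | (ring; done) | linear_combination -hd
    rw [this]
    exact H.mul_mem (H.mul_mem (hu _) (hl _)) (hu _)
  rw [eq_top_iff]
  intro g _
  by_cases hg : g 1 0 = 0
  · have hd := det_eq_one g
    have h0 : g 0 0 ≠ 0 := by rintro e; rw [e, hg] at hd; simp at hd
    -- Left multiplication by `lower 1` makes the lower left entry nonzero.
    have := key (lower 1 * g) (by simpa [lower, mul_10, hg] using h0)
    have h2 := H.mul_mem (H.inv_mem (hl 1)) this
    rwa [inv_mul_cancel_left] at h2
  · exact key g hg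

variable {K : Type*} [Field K] [DecidableEq K] [Algebra F K]

lemma zero_mem_affineOrbit_iff {H : Subgroup SL(2, F)} :
    0 ∈ affineOrbit H K ↔ ∃ h ∈ H, h 1 0 ≠ 0 ∧ h 0 0 = 0 := by
  constructor
  · rintro ⟨h, hh⟩
    change h.1 • (∞ : OnePoint K) = _ at hh
    have hc : h.1 1 0 ≠ 0 := by
      intro hc
      rw [(smul_infty_eq_infty_iff (K := K) h.1).2 hc] at hh
      exact infty_ne_coe _ hh
    refine ⟨h.1, h.2, hc, ?_⟩
    rw [smul_infty_of_ne hc, coe_eq_coe] at hh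
    have := (algebraMap F K).injective hh
    simpa [hc] using this
  · rintro ⟨h, hh, hc, ha⟩
    refine ⟨⟨h, hh⟩, ?_⟩
    change h • (∞ : OnePoint K) = _
    rw [smul_infty_of_ne hc, ha, zero_div]

lemma eq_top_of_translations_eq_top {H : Subgroup SL(2, F)} (hT : ∀ t, t ∈ translations H)
    {h : SL(2, F)} (hh : h ∈ H) (hc : h 1 0 ≠ 0) (ha : h 0 0 = 0) : H = ⊤ := by
  refine eq_top_of_upper_of_lower hT fun s => ?_
  have hd := det_eq_one h
  rw [ha, zero_mul, zero_sub] at hd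
  have : lower s = h * upper (-s / h 1 0 ^ 2) * h⁻¹ := by
    apply ext_entries <;> simp only [upper, lower, mul_00, mul_01, mul_10, mul_11, mk_00, mk_01,
      mk_10, mk_11, inv_00, inv_01, inv_10, inv_11, ha]
    · linear_combination -hd
    · ring
    · field_simp; ring
    · linear_combination -hd
  rw [this]
  exact H.mul_mem (H.mul_mem hh (hT _)) (H.inv_mem hh)

lemma smul_mem_affineOrbit {H : Subgroup SL(2, F)} {h : SL(2, F)} (hh : h ∈ H) {s : F}
    (hs : s ∈ affineOrbit H K) (hne : h 1 0 * s + h 1 1 ≠ 0) :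
    (h 0 0 * s + h 0 1) / (h 1 0 * s + h 1 1) ∈ affineOrbit H K := by
  have e : h • ((algebraMap F K s : K) : OnePoint K) = ((algebraMap F K
      ((h 0 0 * s + h 0 1) / (h 1 0 * s + h 1 1)) : K) : OnePoint K) := by
    rw [smul_coe_ite, if_neg]
    · simp
    · rw [← map_mul, ← map_add, map_eq_zero]; exact hne
  change _ ∈ orbit H (∞ : OnePoint K)
  rw [← e]
  obtain ⟨g, hg⟩ := hs
  exact ⟨⟨h, hh⟩ * g, by rw [← hg]; exact mul_smul _ _ _⟩

lemma div_mem_affineOrbit {H : Subgroup SL(2, F)} {h : SL(2, F)} (hh : h ∈ H) (hc : h 1 0 ≠ 0) :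
    h 0 0 / h 1 0 ∈ affineOrbit H K :=
  ⟨⟨h, hh⟩, smul_infty_of_ne hc⟩

/-- When c = h₁₀ ≠ 0, the points h∞ = e₁t₀, h⁻¹∞ = e₂t₀ and h(h⁻¹∞ + t₀) = e₃t₀ all lie in E·t₀. The
determinant relation gives (e₁ - e₃)(ct₀)² = 1, and the trace is ct₀(e₁ - e₂). Only the square of
ct₀ is known to lie in E, hence the squared trace. -/
lemma tr_sq_mem {H : Subgroup SL(2, F)} {E : Subfield F} {t₀ : F} (h0 : t₀ ≠ 0)
    (hΛ : ∀ u ∈ dilations H, (u : F) ∈ E)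
    (hT : ∀ t, t ∈ affineOrbit H K ↔ ∃ e ∈ E, t = e * t₀) {h : SL(2, F)} (hh : h ∈ H) :
    tr h ^ 2 ∈ E := by
  have hd := det_eq_one h
  by_cases hc : h 1 0 = 0
  · rw [hc, mul_zero, sub_zero] at hd
    have ha : h 0 0 ≠ 0 := by intro e; rw [e] at hd; simp at hd
    have h1 : h 0 0 ^ 2 ∈ E :=
      hΛ (Units.mk0 (h 0 0 ^ 2) (pow_ne_zero 2 ha)) (mem_dilations.2 ⟨h, hh, hc, rfl⟩)
    have h2 : tr h ^ 2 = h 0 0 ^ 2 + (1 + 1) + (h 0 0 ^ 2)⁻¹ := by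
      rw [tr, eq_inv_of_mul_eq_one_right hd]
      field_simp
      ring
    rw [h2]
    exact E.add_mem (E.add_mem h1 (E.add_mem E.one_mem E.one_mem)) (E.inv_mem h1)
  · obtain ⟨e₁, he₁, h1⟩ := (hT _).1 (div_mem_affineOrbit hh hc)
    obtain ⟨e₂, he₂, h2⟩ := (hT _).1 (div_mem_affineOrbit (H.inv_mem hh)
      (by rw [inv_10]; exact neg_ne_zero.2 hc))
    rw [inv_00, inv_10] at h2
    have hs : (1 + e₂) * t₀ ∈ affineOrbit H K := (hT _).2 ⟨_, E.add_mem E.one_mem he₂, rfl⟩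
    have h2' : h 1 1 = - (e₂ * t₀ * h 1 0) := by rw [← h2]; field_simp
    have h1' : h 0 0 = e₁ * t₀ * h 1 0 := by rw [← h1]; field_simp
    have hcs : h 1 0 * ((1 + e₂) * t₀) + h 1 1 = h 1 0 * t₀ := by rw [h2']; ring
    have hm := smul_mem_affineOrbit hh hs (by rw [hcs]; exact mul_ne_zero hc h0)
    rw [hcs] at hm
    obtain ⟨e₃, he₃, h3⟩ := (hT _).1 hm
    have hkey : (e₁ - e₃) * (h 1 0 * t₀) ^ 2 = 1 := by
      rw [div_eq_iff (mul_ne_zero hc h0)] at h3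
      rw [h1', h2'] at hd
      rw [h1'] at h3
      linear_combination hd + h 1 0 * h3
    have hmem : (h 1 0 * t₀) ^ 2 ∈ E := by
      rw [eq_inv_of_mul_eq_one_right hkey]
      exact E.inv_mem (E.sub_mem he₁ he₃)
    have : tr h ^ 2 = (h 1 0 * t₀) ^ 2 * (e₁ - e₂) ^ 2 := by rw [tr, h1', h2']; ring
    rw [this]
    exact E.mul_mem hmem (E.pow_mem (E.sub_mem he₁ he₂) 2)

end Structure

/-! ### Subgroups containing a split and a nonsplit element. -/

section Main

open MulAction OnePoint

variable {F : Type*} [Field F]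

/-- The diagonal matrix with entries `l, l⁻¹`. -/
def diag (l : F) (hl : l ≠ 0) : SL(2, F) := mk l 0 0 l⁻¹ (by field_simp; ring)

lemma four_le_card_dilations [Finite F] {H : Subgroup SL(2, F)} {l : F} (hl : l ≠ 0)
    (hlH : diag l hl ∈ H) (hl12 : l ^ 12 ≠ 1) : 4 ≤ Nat.card (dilations H) := by
  have hu : Units.mk0 l hl ^ 2 ∈ dilations H :=
    mem_dilations.2 ⟨_, hlH, rfl, by simp [diag]⟩
  by_contra! hlt
  have hpos : 0 < Nat.card (dilations H) := Nat.card_pos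
  -- Orders 1, 2 and 3 all divide 6, and l² is a dilation; this is where the exponent 12 comes from.
  have h6 : Nat.card (dilations H) ∣ 6 := by
    interval_cases Nat.card (dilations H) <;> decide
  have h1 : (⟨_, hu⟩ : dilations H) ^ 6 = 1 :=
    orderOf_dvd_iff_pow_eq_one.1 ((orderOf_dvd_natCard _).trans h6)
  have h2 := congrArg (fun v : dilations H => ((v : Fˣ) : F)) h1
  simp only [Subgroup.coe_pow, Units.val_pow_eq_pow_val, Units.val_mk0, Subgroup.coe_one,
    Units.val_one, ← pow_mul] at h2
  exact hl12 h2

variable {K : Type*} [Field K] [DecidableEq K] [Algebra F K]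

lemma four_mul_le_card_stabilizer [Finite F] {H : Subgroup SL(2, F)} (hH : -1 ∈ H) {y : SL(2, F)}
    (hy : y ∈ H) (hy12 : y ^ 12 ≠ 1) {Q : OnePoint K} (hQ : y • Q = Q) :
    4 * Nat.card (Subgroup.center SL(2, F)) ≤ Nat.card (stabilizer H Q) := by
  have hle : (Subgroup.center SL(2, F)).subgroupOf H ≤ stabilizer H Q :=
    fun g hg => smul_of_mem_center (Subgroup.mem_subgroupOf.1 hg) Q
  obtain ⟨m, hm⟩ := Subgroup.card_dvd_of_le hle
  rw [card_center_subgroupOf hH] at hm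
  rw [hm, mul_comm]
  apply Nat.mul_le_mul_left
  by_contra! hlt
  have hpos : 0 < Nat.card (stabilizer H Q) := Nat.card_pos
  have hm0 : m ≠ 0 := by rintro rfl; omega
  have h6 : m ∣ 6 := by
    interval_cases m
    · omega
    · decide
    · decide
    · decide
  have h12 : Nat.card (stabilizer H Q) ∣ 12 := by
    rw [hm]; exact mul_dvd_mul card_center_dvd_two h6
  have h1 : (⟨⟨y, hy⟩, hQ⟩ : stabilizer H Q) ^ 12 = 1 :=
    orderOf_dvd_iff_pow_eq_one.1 ((orderOf_dvd_natCard _).trans h12)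
  exact hy12 (congrArg (fun v : stabilizer H Q => (v : H).1) h1)

lemma lower_left_ne_zero {y : SL(2, F)} (hy : ∀ μ : F, μ ^ 2 - tr y * μ + 1 ≠ 0) :
    y 1 0 ≠ 0 := by
  intro hc
  have hd := det_eq_one y
  rw [hc] at hd
  exact hy (y 0 0) (by rw [tr]; linear_combination -hd)

lemma exists_irrational_fixed_point [IsAlgClosed K] {y : SL(2, F)}
    (hy : ∀ μ : F, μ ^ 2 - tr y * μ + 1 ≠ 0) :
    ∃ k : K, y • (k : OnePoint K) = k ∧ ∀ s : F, algebraMap F K s ≠ k := by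
  have hc := lower_left_ne_zero hy
  have hd := det_eq_one y
  have hz : y ∉ Subgroup.center SL(2, F) := by
    rw [mem_center_iff_eq]
    rintro (rfl | rfl) <;> simp at hc
  have hrat : ∀ s : F, y • ((algebraMap F K s : K) : OnePoint K) ≠ (algebraMap F K s : K) := by
    intro s hs
    rw [smul_coe_eq_self_iff, ← map_sub, ← map_pow, ← map_mul, ← map_mul,
        ← map_add, ← map_sub, map_eq_zero] at hs
    refine hy (y 1 0 * s + y 1 1) ?_
    rw [tr]
    linear_combination y 1 0 * hs - hd
  obtain ⟨P, Q, hPQ⟩ := exists_fixedBy_eq_pair (K := K) hz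
  have hP : P ∈ fixedBy (OnePoint K) y := hPQ ▸ Set.mem_insert P {Q}
  rw [mem_fixedBy] at hP
  induction P using OnePoint.rec with
  | infty => exact absurd ((smul_infty_eq_infty_iff (K := K) y).1 hP) hc
  | coe k =>
    refine ⟨k, hP, ?_⟩
    rintro s rfl
    exact hrat s hP

/-- Matrices over F preserve the F-rational points together with ∞. -/
lemma orbit_coe_ne_of_irrational {H : Subgroup SL(2, F)} {k : K}
    (hk : ∀ s : F, algebraMap F K s ≠ k) (s : F) :
    orbit H ((algebraMap F K s : K) : OnePoint K) ≠ orbit H (k : OnePoint K) := by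
  intro e
  obtain ⟨h, hh⟩ := e ▸ mem_orbit_self (M := H) (k : OnePoint K)
  change h.1 • ((algebraMap F K s : K) : OnePoint K) = _ at hh
  rw [smul_coe_ite] at hh
  split_ifs at hh with h0
  · exact infty_ne_coe _ hh
  · rw [coe_eq_coe] at hh
    exact hk ((h.1 0 0 * s + h.1 0 1) / (h.1 1 0 * s + h.1 1 1)) (by rw [← hh]; simp)

lemma orbit_infty_ne_of_irrational {H : Subgroup SL(2, F)} {k : K}
    (hk : ∀ s : F, algebraMap F K s ≠ k) :
    orbit H (∞ : OnePoint K) ≠ orbit H (k : OnePoint K) := by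
  intro e
  have : (k : OnePoint K) ∈ orbit H (∞ : OnePoint K) := e ▸ mem_orbit_self _
  rw [orbit_infty_eq] at this
  rcases this with h | ⟨s, -, hs⟩
  · exact coe_ne_infty _ h
  · exact hk s (coe_injective hs)

/-- A subgroup of `SL(2, F)` that contains a split and a nonsplit torus element of large order is
everything, or it is defined over a proper subfield up to scalars. -/
theorem eq_top_or_exists_subfield [Finite F] {H : Subgroup SL(2, F)} (hH : -1 ∈ H) {l : F}
    (hl : l ≠ 0) (hlH : diag l hl ∈ H) (hl12 : l ^ 12 ≠ 1) {y : SL(2, F)} (hyH : y ∈ H)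
    (hy : ∀ μ : F, μ ^ 2 - tr y * μ + 1 ≠ 0) (hy12 : y ^ 12 ≠ 1) :
    H = ⊤ ∨ ∃ E : Subfield F, E ≠ ⊤ ∧ ∀ h ∈ H, tr h ^ 2 ∈ E := by
  classical
  let K := AlgebraicClosure F
  have := Fintype.ofFinite H
  set Z := (Subgroup.center SL(2, F)).subgroupOf H with hZdef
  set z := Nat.card (Subgroup.center SL(2, F)) with hz
  have hzpos : 0 < z := Nat.card_pos
  have hZcard : Nat.card Z = z := card_center_subgroupOf hH
  have hZ : ∀ g ∈ Z, ∀ x : OnePoint K, g • x = x :=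
    fun g hg x => smul_of_mem_center (Subgroup.mem_subgroupOf.1 hg) x
  have hF : ∀ g ∉ Z, ∃ a b : OnePoint K, fixedBy (OnePoint K) g = {a, b} :=
    fun g hg => exists_fixedBy_eq_pair (g := g.1) fun h => hg (Subgroup.mem_subgroupOf.2 h)
  obtain ⟨k, hyk, hk⟩ := exists_irrational_fixed_point (K := K) hy
  have hc4 := four_le_card_dilations hl hlH hl12
  have hrpos : 0 < Nat.card (translations H) := Nat.card_pos
  have hst : Nat.card (stabilizer H (∞ : OnePoint K)) =
      z * Nat.card (translations H) * Nat.card (dilations H) := by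
    rw [card_stabilizer_infty, card_borel hH]
  have hP4 : 4 * Nat.card Z ≤ Nat.card (stabilizer H (∞ : OnePoint K)) := by
    rw [hst, hZcard]
    calc 4 * z = z * 1 * 4 := by ring
      _ ≤ _ := by gcongr; exact hrpos
  have hQ4 : 4 * Nat.card Z ≤ Nat.card (stabilizer H (k : OnePoint K)) := by
    rw [hZcard]; exact four_mul_le_card_stabilizer hH hyH hy12 hyk
  have hPQ := orbit_infty_ne_of_irrational (H := H) hk
  -- The diagonal element also fixes 0, so 0 lies in one of the two special orbits, and the orbit of
  -- k contains no rational point.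
  have hzero : (0 : F) ∈ affineOrbit H K := by
    have hdz : (⟨diag l hl, hlH⟩ : H) ∉ Z := by
      rw [Subgroup.mem_subgroupOf, mem_center_iff_eq]
      rintro (e | e)
      · have : l = 1 := congrArg (fun g : SL(2, F) => g 0 0) e
        exact hl12 (by rw [this, one_pow])
      · have : l = -1 := congrArg (fun g : SL(2, F) => g 0 0) e
        exact hl12 (by rw [this]; norm_num)
    have hfix : (⟨diag l hl, hlH⟩ : H) • ((algebraMap F K 0 : K) : OnePoint K) =
        (algebraMap F K 0 : K) := by
      refine (smul_coe_eq_self_iff (diag l hl) (algebraMap F K 0)).2 ?_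
      simp [diag]
    rcases orbit_eq_or_orbit_eq hZ hF hP4 hQ4 hPQ hdz hfix with e | e
    · exact orbit_eq_iff.1 e
    · exact absurd e (orbit_coe_ne_of_irrational hk 0)
  -- A unique fixed point is always rational, so k is never one.
  have hsole : (soleFixers Z (k : OnePoint K)).card = 0 := by
    rw [Finset.card_eq_zero, Finset.eq_empty_iff_forall_notMem]
    intro g hg
    simp only [soleFixers, Finset.mem_filter] at hg
    obtain ⟨s, hs⟩ := exists_fixedBy_eq_coe_algebraMap (g := g.1) hg.2.2
    exact hk s hs
  have hcount := card_orbit_mul_card_soleFixers hZ hF hP4 hQ4 hPQ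
  have hsP := card_soleFixers_infty (K := K) hH
  obtain ⟨m, hm⟩ := card_translations_dvd (H := H) (K := K)
  have hN := card_orbit_infty (H := H) (K := K)
  have hoP := card_orbit_mul_card_stabilizer (G := H) (∞ : OnePoint K)
  have hoQ := card_orbit_mul_card_stabilizer (G := H) (k : OnePoint K)
  have hle : Z ≤ stabilizer H (k : OnePoint K) := fun g hg => hZ g hg _
  obtain ⟨e, he⟩ := Subgroup.card_dvd_of_le hle
  rw [hZcard] at he
  have hMpos : 1 ≤ Nat.card (orbit H (k : OnePoint K)) := by
    have := (finite_orbit' (G := H) (k : OnePoint K)).to_subtype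
    have : Nonempty (orbit H (k : OnePoint K)) := ⟨⟨_, mem_orbit_self _⟩⟩
    exact Nat.card_pos
  have hmpos : 1 ≤ m := by
    rw [Nat.one_le_iff_ne_zero]
    rintro rfl
    rw [mul_zero, Set.ncard_eq_zero (Set.toFinite _)] at hm
    rw [hm] at hzero
    exact hzero
  have h1 : Nat.card (orbit H (∞ : OnePoint K)) * Nat.card (translations H) + 2 =
      2 * Nat.card (orbit H (∞ : OnePoint K)) + Nat.card (orbit H (k : OnePoint K)) := by
    rw [hsole, hZcard] at hcount
    apply Nat.eq_of_mul_eq_mul_left hzpos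
    have := congrArg (fun n => Nat.card (orbit H (∞ : OnePoint K)) * n) hsP
    simp only [← hz] at this
    linarith
  have h2 : Nat.card (orbit H (k : OnePoint K)) * e = Nat.card (orbit H (∞ : OnePoint K)) *
      (Nat.card (translations H) * Nat.card (dilations H)) := by
    rw [hst] at hoP
    rw [he, ← hoP] at hoQ
    apply Nat.eq_of_mul_eq_mul_left hzpos
    linarith
  obtain ⟨rfl, hdvd⟩ := eq_one_and_dvd_of_orbit_equation hc4 card_dilations_dvd hrpos hmpos
    (by rw [hN, hm]) hMpos h1 h2
  rw [mul_one] at hm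
  have hr1 : 1 < Nat.card (translations H) := by
    by_contra! hle
    have hr : Nat.card (translations H) = 1 := by omega
    rw [hr, Nat.sub_self, zero_dvd_iff] at hdvd
    omega
  obtain ⟨E, t₀, ht₀, hΛ, hT⟩ := exists_subfield_of_dilations hr1 hdvd
  -- Since 0 is in the orbit, all translations are; m = 1 makes the cardinalities agree.
  have hA : ∀ t, t ∈ affineOrbit H K ↔ t ∈ translations H := by
    have hsub : (translations H : Set F) ⊆ affineOrbit H K := by
      intro t ht
      simpa using add_mem_affineOrbit hzero ht
    have := Set.eq_of_subset_of_ncard_le hsub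
      (by rw [hm, ← Nat.card_coe_set_eq]; exact le_rfl) (Set.toFinite _)
    intro t
    rw [← this]
    rfl
  by_cases hE : E = ⊤
  · left
    obtain ⟨h, hh, hc, ha⟩ := zero_mem_affineOrbit_iff.1 hzero
    refine eq_top_of_translations_eq_top (fun t => (hT t).2 ⟨t / t₀, hE ▸ Subfield.mem_top _, ?_⟩)
      hh hc ha
    field_simp
  · right
    exact ⟨E, hE, fun h hh => tr_sq_mem ht₀ hΛ (fun t => (hA t).trans (hT t)) hh⟩

end Main

/-! ### Conjugacy classes of PSL₂(F): which pairs fail and which generate. -/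

section Classes

variable {F : Type*} [Field F]

/-- The conjugacy class in `PSL(2, F)` of the image of an element of `SL(2, F)`. -/
def classOf (g : SL(2, F)) : ConjClasses (Matrix.ProjectiveSpecialLinearGroup (Fin 2) F) :=
  ConjClasses.mk (QuotientGroup.mk' (Subgroup.center SL(2, F)) g)

lemma exists_eq_classOf (C : ConjClasses (Matrix.ProjectiveSpecialLinearGroup (Fin 2) F)) :
    ∃ g, C = classOf g := by
  obtain ⟨x, rfl⟩ := ConjClasses.exists_rep C
  obtain ⟨g, rfl⟩ := QuotientGroup.mk'_surjective _ x
  exact ⟨g, rfl⟩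

lemma classOf_eq_of_isConj {g h : SL(2, F)} (e : IsConj g h) : classOf g = classOf h :=
  ConjClasses.mk_eq_mk_iff_isConj.2 (MonoidHom.map_isConj _ e)

lemma classOf_neg (g : SL(2, F)) : classOf (-g) = classOf g := by
  have : QuotientGroup.mk' (Subgroup.center SL(2, F)) (-g) = QuotientGroup.mk' _ g := by
    rw [QuotientGroup.mk'_eq_mk']
    exact ⟨-1, (mem_center_iff_eq _).2 (Or.inr rfl), by simp⟩
  rw [classOf, this, classOf]

lemma exists_conj_of_mem_carrier {g : SL(2, F)}
    {x : Matrix.ProjectiveSpecialLinearGroup (Fin 2) F} (hx : x ∈ (classOf g).carrier) :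
    ∃ k, x = QuotientGroup.mk' (Subgroup.center SL(2, F)) (k * g * k⁻¹) := by
  rw [ConjClasses.mem_carrier_iff_mk_eq, classOf, ConjClasses.mk_eq_mk_iff_isConj] at hx
  obtain ⟨c, hc⟩ := isConj_iff.1 hx.symm
  obtain ⟨k, rfl⟩ := QuotientGroup.mk'_surjective _ c
  exact ⟨k, by rw [← hc, map_mul, map_mul, map_inv]⟩

lemma tr_eq_or_eq_neg_of_classOf_eq {g h : SL(2, F)} (e : classOf g = classOf h) :
    tr g = tr h ∨ tr g = - tr h := by
  have hx : QuotientGroup.mk' (Subgroup.center SL(2, F)) g ∈ (classOf h).carrier := by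
    rw [ConjClasses.mem_carrier_iff_mk_eq]; exact e
  obtain ⟨k, hk⟩ := exists_conj_of_mem_carrier hx
  rw [QuotientGroup.mk'_eq_mk'] at hk
  obtain ⟨ζ, hζ, hk⟩ := hk
  rcases (mem_center_iff_eq _).1 hζ with rfl | rfl
  · left; rw [← tr_conj k h, ← hk, mul_one]
  · right; rw [← tr_conj k h, ← hk, mul_neg, mul_one, tr_neg, neg_neg]

/-- The class of the elements of trace `t`, for `t ^ 2 ≠ 4`. -/
def traceClass (t : F) : ConjClasses (Matrix.ProjectiveSpecialLinearGroup (Fin 2) F) :=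
  classOf (stdForm t 1 one_ne_zero)

lemma traceClass_eq_imp {s t : F} (h : traceClass s = traceClass t) : s = t ∨ s = -t := by
  simpa only [tr_stdForm] using tr_eq_or_eq_neg_of_classOf_eq h

lemma classOf_eq_traceClass [Finite F] {g : SL(2, F)} (h : tr g ^ 2 ≠ 4) :
    classOf g = traceClass (tr g) :=
  (classOf_eq_of_isConj (isConj_stdForm_one g h)).symm

lemma traceClass_neg [Finite F] {t : F} (h : t ^ 2 ≠ 4) : traceClass (-t) = traceClass t := by
  rw [traceClass, traceClass, ← classOf_neg (stdForm t 1 one_ne_zero),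
    classOf_eq_traceClass (g := - stdForm t 1 one_ne_zero), tr_neg, tr_stdForm, traceClass]
  rwa [tr_neg, tr_stdForm, neg_sq]

/-- Traces of regular split semisimple elements. -/
def splitTraces (F : Type*) [Field F] : Set F := {t | t ^ 2 ≠ 4 ∧ ∃ μ : F, μ ^ 2 - t * μ + 1 = 0}

/-- Traces of elements without eigenvalues in `F`. -/
def nonsplitTraces (F : Type*) [Field F] : Set F := {t | ∀ μ : F, μ ^ 2 - t * μ + 1 ≠ 0}

lemma sq_ne_four_of_mem_nonsplitTraces {t : F} (h : t ∈ nonsplitTraces F) : t ^ 2 ≠ 4 := by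
  intro e
  have : (t - 2) * (t + 2) = 0 := by linear_combination e
  rcases mul_eq_zero.1 this with e | e
  · exact h 1 (by linear_combination -e)
  · exact h (-1) (by linear_combination e)

lemma exists_diag_of_mem_splitTraces {t : F} (h : t ∈ splitTraces F) :
    ∃ (l : F) (hl : l ≠ 0), tr (diag l hl) = t ∧ l ^ 2 - t * l + 1 = 0 := by
  obtain ⟨-, l, hl⟩ := h
  have h0 : l ≠ 0 := by rintro rfl; simp at hl
  refine ⟨l, h0, ?_, hl⟩
  simp only [tr, diag, mk_00, mk_11]
  field_simp
  linear_combination hl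

lemma not_invariablyGenerates_of_commute {G : Type*} [Group G] {x y : G} (h : Commute x y)
    (hG : ∃ a b : G, a * b ≠ b * a) :
    ¬ InvariablyGenerates {ConjClasses.mk x, ConjClasses.mk y} := by
  classical
  intro hinv
  have key : ∀ (S : Set G), (∀ a ∈ S, ∀ b ∈ S, a * b = b * a) → Subgroup.closure S ≠ ⊤ := by
    intro S hS htop
    obtain ⟨a, b, hab⟩ := hG
    have h1 : S ⊆ Subgroup.centralizer S := fun a ha => by
      rw [SetLike.mem_coe, Subgroup.mem_centralizer_iff]
      exact fun b hb => hS b hb a ha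
    have h2 : Subgroup.centralizer S = ⊤ := by
      rw [eq_top_iff, ← htop, Subgroup.closure_le]; exact h1
    have h3 : S ⊆ Subgroup.center G := Subgroup.centralizer_eq_top_iff_subset.1 h2
    have h4 : Subgroup.center G = ⊤ := by
      rw [eq_top_iff, ← htop, Subgroup.closure_le]; exact h3
    have : a ∈ Subgroup.center G := h4 ▸ Subgroup.mem_top a
    exact hab ((Subgroup.mem_center_iff.1 this b).symm)
  -- If the two classes coincide, x is chosen for both.
  let f : ConjClasses G → G := fun C => if C = ConjClasses.mk x then x else y
  refine key _ ?_ (hinv f ?_)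
  · have hf : ∀ a ∈ f '' {ConjClasses.mk x, ConjClasses.mk y}, a = x ∨ a = y := by
      rintro _ ⟨C, -, rfl⟩
      simp only [f]
      split_ifs <;> simp
    intro a ha b hb
    rcases hf a ha with rfl | rfl <;> rcases hf b hb with rfl | rfl
    · rfl
    · exact h
    · exact h.symm
    · rfl
  · rintro C (rfl | rfl)
    · simp [f, ConjClasses.mem_carrier_iff_mk_eq]
    · simp only [f]
      split_ifs with e
      · rw [ConjClasses.mem_carrier_iff_mk_eq, e]
      · rw [ConjClasses.mem_carrier_iff_mk_eq]

lemma exists_not_commute (F : Type*) [Field F] :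
    ∃ a b : Matrix.ProjectiveSpecialLinearGroup (Fin 2) F, a * b ≠ b * a := by
  refine ⟨QuotientGroup.mk' _ (upper 1), QuotientGroup.mk' _ (lower 1), fun e => ?_⟩
  rw [← map_mul, ← map_mul, QuotientGroup.mk'_eq_mk'] at e
  obtain ⟨ζ, hζ, e⟩ := e
  have h0 := congrArg (fun g : SL(2, F) => g 0 0) e
  have h1 := congrArg (fun g : SL(2, F) => g 0 1) e
  rcases (mem_center_iff_eq _).1 hζ with rfl | rfl
  · simp [mul_00, upper, lower] at h0
  · simp [mul_00, mul_01, upper, lower] at h0 h1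
    exact one_ne_zero (α := F) (by linear_combination -h0 + h1)

lemma not_invariablyGenerates_classOf {g h : SL(2, F)} (e : g * h = h * g) :
    ¬ InvariablyGenerates {classOf g, classOf h} :=
  not_invariablyGenerates_of_commute (Commute.map e _) (exists_not_commute F)

lemma not_invariablyGenerates_split [Finite F] {s t : F} (hs : s ∈ splitTraces F)
    (ht : t ∈ splitTraces F) : ¬ InvariablyGenerates {traceClass s, traceClass t} := by
  obtain ⟨l, hl, rfl, -⟩ := exists_diag_of_mem_splitTraces hs
  obtain ⟨m, hm, rfl, -⟩ := exists_diag_of_mem_splitTraces ht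
  rw [← classOf_eq_traceClass hs.1, ← classOf_eq_traceClass ht.1]
  apply not_invariablyGenerates_classOf
  apply ext_entries <;> simp [mul_00, mul_01, mul_10, mul_11, diag] <;> ring

/-- For σ of trace s and determinant 1, the conditions say that a + bσ has trace t and norm 1, so
the torus of σ contains an element of trace t. In odd characteristic this amounts to b²(s² - 4) = t²
- 4, solvable because both discriminants are nonsquares. In characteristic 2 the Artin–Schreier map
x² + x replaces squaring: its image has index 2, and s⁻², t⁻² both lie outside it. -/
lemma exists_sq_add_mul_add_sq_eq_one [Finite F] {s t : F} (hs : s ∈ nonsplitTraces F)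
    (ht : t ∈ nonsplitTraces F) : ∃ a b : F, 2 * a + b * s = t ∧ a ^ 2 + a * b * s + b ^ 2 = 1 := by
  have := Fintype.ofFinite F
  have hns : ∀ t ∈ nonsplitTraces F, (2 : F) ≠ 0 → ¬ IsSquare (t ^ 2 - 4) := by
    rintro t ht h2 ⟨r, hr⟩
    apply ht ((t + r) / 2)
    field_simp
    linear_combination -hr
  by_cases h2 : (2 : F) = 0
  · have hs0 : s ≠ 0 := fun e => hs 1 (by rw [e]; linear_combination h2)
    have ht0 : t ≠ 0 := fun e => ht 1 (by rw [e]; linear_combination h2)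
    let f : F →+ F := ⟨⟨fun x => x ^ 2 + x, by simp⟩, fun x y => by
      simp only; linear_combination x * y * h2⟩
    have hf : ∀ x, f x = x ^ 2 + x := fun x => rfl
    have hker : (f.ker : Set F) = {0, 1} := by
      ext x
      simp only [SetLike.mem_coe, AddMonoidHom.mem_ker, hf, Set.mem_insert_iff,
        Set.mem_singleton_iff]
      rw [show x ^ 2 + x = x * (x - 1) by linear_combination x * h2, mul_eq_zero, sub_eq_zero]
    have hcard : f.range.index = 2 := by
      rw [AddSubgroup.index_range]
      rw [show Nat.card f.ker = (f.ker : Set F).ncard from Nat.card_coe_set_eq _, hker,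
        Set.ncard_pair zero_ne_one]
    have hnot : ∀ t ∈ nonsplitTraces F, t ≠ 0 → (t⁻¹) ^ 2 ∉ f.range := by
      rintro t ht ht0 ⟨x, hx⟩
      rw [hf] at hx
      apply ht (t * x)
      field_simp at hx
      linear_combination hx + (1 - t ^ 2 * x) * h2
    have hmem : (s⁻¹) ^ 2 + (t⁻¹) ^ 2 ∈ f.range := by
      rw [AddSubgroup.add_mem_iff_of_index_two hcard]
      exact iff_of_false (hnot s hs hs0) (hnot t ht ht0)
    obtain ⟨x, hx⟩ := hmem
    rw [hf] at hx
    refine ⟨t * x, t / s, ?_, ?_⟩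
    · field_simp; linear_combination x * h2
    · field_simp at hx ⊢
      linear_combination hx + (t ^ 2 ) * h2
  · obtain ⟨r, hr⟩ := isSquare_mul_of_not_isSquare (hns s hs h2) (hns t ht h2)
    have h0 : s ^ 2 - 4 ≠ 0 := sub_ne_zero.2 (sq_ne_four_of_mem_nonsplitTraces hs)
    have hb : (r / (s ^ 2 - 4)) ^ 2 * (s ^ 2 - 4) = t ^ 2 - 4 := by
      field_simp
      linear_combination -hr
    refine ⟨(t - r / (s ^ 2 - 4) * s) / 2, r / (s ^ 2 - 4), by field_simp; ring, ?_⟩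
    generalize r / (s ^ 2 - 4) = b at hb
    field_simp
    linear_combination -hb

lemma not_invariablyGenerates_nonsplit [Finite F] {s t : F} (hs : s ∈ nonsplitTraces F)
    (ht : t ∈ nonsplitTraces F) : ¬ InvariablyGenerates {traceClass s, traceClass t} := by
  obtain ⟨a, b, h1, h2⟩ := exists_sq_add_mul_add_sq_eq_one hs ht
  have hd : a * (a + b * s) - (-b) * b = 1 := by linear_combination h2
  have htr : tr (mk a (-b) b (a + b * s) hd) = t := by
    simp only [tr, mk_00, mk_11]; linear_combination h1
  rw [← htr, ← classOf_eq_traceClass (by rw [htr]; exact sq_ne_four_of_mem_nonsplitTraces ht)]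
  apply not_invariablyGenerates_classOf
  apply ext_entries <;> simp [mul_00, mul_01, mul_10, mul_11, stdForm] <;> ring

/-- Classes of elements whose trace is `2` or `-2`. -/
def irregularClasses (F : Type*) [Field F] :
    Set (ConjClasses (Matrix.ProjectiveSpecialLinearGroup (Fin 2) F)) :=
  {C | ∃ g : SL(2, F), tr g ^ 2 = 4 ∧ C = classOf g}

/-- Up to sign the trace is 2. A nonscalar such element is conjugate to `stdForm 2 δ` for any
nonzero value δ of its form, and rescaling v changes δ by squares, leaving at most two classes
besides the identity. -/
lemma ncard_irregularClasses_le (F : Type*) [Field F] [Finite F] :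
    (irregularClasses F).ncard ≤ 3 := by
  obtain ⟨ν, hν, H⟩ := exists_nonsquare_class F
  have hsub : irregularClasses F ⊆ {classOf 1, classOf (stdForm 2 1 one_ne_zero),
      classOf (stdForm 2 ν hν)} := by
    have key : ∀ g : SL(2, F), tr g = 2 → classOf g ∈ ({classOf 1,
        classOf (stdForm 2 1 one_ne_zero), classOf (stdForm 2 ν hν)} :
          Set (ConjClasses (Matrix.ProjectiveSpecialLinearGroup (Fin 2) F))) := by
      intro g hg
      by_cases h1 : g = 1
      · rw [h1]; simp
      by_cases h2 : g = -1
      · rw [h2, classOf_neg]; simp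
      obtain ⟨x, y, hxy⟩ := exists_form_ne_zero g h1 h2
      obtain ⟨s, hs | hs⟩ := H _ hxy
      · have := isConj_stdForm g (x * s) (y * s) 1 one_ne_zero (by linear_combination hs)
        rw [hg] at this
        rw [← classOf_eq_of_isConj this]; simp
      · have := isConj_stdForm g (x * s) (y * s) ν hν (by linear_combination hs)
        rw [hg] at this
        rw [← classOf_eq_of_isConj this]; simp
    rintro _ ⟨g, hg, rfl⟩
    rcases sq_eq_sq_iff_eq_or_eq_neg.1 (show tr g ^ 2 = 2 ^ 2 by rw [hg]; norm_num) with e | e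
    · exact key g e
    · rw [← classOf_neg g]
      exact key _ (by rw [tr_neg, e, neg_neg])
  refine (Set.ncard_le_ncard hsub (Set.toFinite _)).trans ?_
  refine (Set.ncard_insert_le _ _).trans ?_
  have := Set.ncard_insert_le (classOf (stdForm 2 1 one_ne_zero : SL(2, F)))
    {classOf (stdForm 2 ν hν)}
  rw [Set.ncard_singleton] at this
  omega

lemma class_cases [Finite F] (C : ConjClasses (Matrix.ProjectiveSpecialLinearGroup (Fin 2) F)) :
    C ∈ irregularClasses F ∨ C ∈ traceClass '' splitTraces F ∨
      C ∈ traceClass '' nonsplitTraces F := by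
  obtain ⟨g, rfl⟩ := exists_eq_classOf C
  by_cases h : tr g ^ 2 = 4
  · exact Or.inl ⟨g, h, rfl⟩
  right
  rw [classOf_eq_traceClass h]
  by_cases h' : ∃ μ : F, μ ^ 2 - tr g * μ + 1 = 0
  · exact Or.inl ⟨_, ⟨h, h'⟩, rfl⟩
  · push Not at h'
    exact Or.inr ⟨_, h', rfl⟩

/-- Traces of elements whose eigenvalues are twelfth roots of unity. -/
def smallOrderTraces (F : Type*) [Field F] : Set F :=
  {t | ∃ μ : AlgebraicClosure F, μ ^ 12 = 1 ∧
    μ ^ 2 - algebraMap F (AlgebraicClosure F) t * μ + 1 = 0}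

/-- By Cayley–Hamilton, yⁿ = ay + b; the same a and b reduce μⁿ for each root μ of the
characteristic polynomial. -/
lemma exists_pow_eq_linear {K : Type*} [Field K] [Algebra F K] (y : SL(2, F)) (n : ℕ) :
    ∃ a b : F, (y ^ n) 0 0 = a * y 0 0 + b ∧ (y ^ n) 1 0 = a * y 1 0 ∧
      ∀ μ : K, μ ^ 2 - algebraMap F K (tr y) * μ + 1 = 0 →
        μ ^ n = algebraMap F K a * μ + algebraMap F K b := by
  have hd := det_eq_one y
  induction n with
  | zero => exact ⟨0, 1, by simp, by simp, by simp⟩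
  | succ n ih =>
    obtain ⟨a, b, h0, h1, h2⟩ := ih
    refine ⟨a * tr y + b, -a, ?_, ?_, ?_⟩
    · rw [pow_succ', mul_00, h0, h1, tr]; linear_combination -a * hd
    · rw [pow_succ', mul_10, h0, h1, tr]; ring
    · intro μ hμ
      rw [pow_succ, h2 μ hμ]
      simp only [map_add, map_mul, map_neg]
      linear_combination algebraMap F K a * hμ

lemma tr_mem_smallOrderTraces {y : SL(2, F)} (hy : y 1 0 ≠ 0) (h12 : y ^ 12 = 1) :
    tr y ∈ smallOrderTraces F := by
  obtain ⟨a, b, h0, h1, h2⟩ := exists_pow_eq_linear (K := AlgebraicClosure F) y 12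
  rw [h12] at h0 h1
  simp only [one_10, zero_eq_mul, hy, or_false] at h1
  simp only [one_00, h1, zero_mul, zero_add] at h0
  obtain ⟨μ, hμ⟩ := IsAlgClosed.exists_eval₂_eq_zero (RingHom.id (AlgebraicClosure F))
      (Polynomial.C 1 * Polynomial.X ^ 2 +
        Polynomial.C (- algebraMap F (AlgebraicClosure F) (tr y)) * Polynomial.X +
          Polynomial.C 1) (by rw [Polynomial.degree_quadratic one_ne_zero]; decide)
  simp only [Polynomial.eval₂_id, Polynomial.eval_add, Polynomial.eval_mul, Polynomial.eval_C,
    Polynomial.eval_pow, Polynomial.eval_X] at hμ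
  have hμ' : μ ^ 2 - algebraMap F (AlgebraicClosure F) (tr y) * μ + 1 = 0 := by
    linear_combination hμ
  exact ⟨μ, by rw [h2 μ hμ', h1, ← h0]; simp, hμ'⟩

lemma invariablyGenerates_of_mem [Finite F] {s t : F} (hs : s ∈ splitTraces F)
    (ht : t ∈ nonsplitTraces F) (hs' : s ∉ smallOrderTraces F) (ht' : t ∉ smallOrderTraces F)
    (hE : ∀ E : Subfield F, s ^ 2 ∈ E → t ^ 2 ∈ E → E = ⊤) :
    InvariablyGenerates {traceClass s, traceClass t} := by
  intro x hx
  obtain ⟨k₁, h₁⟩ := exists_conj_of_mem_carrier (hx (traceClass s) (by simp))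
  obtain ⟨k₂, h₂⟩ := exists_conj_of_mem_carrier (hx (traceClass t) (by simp))
  rw [Set.image_pair, h₁, h₂]
  set g₁ := k₁ * stdForm s 1 one_ne_zero * k₁⁻¹ with hg₁
  set g₂ := k₂ * stdForm t 1 one_ne_zero * k₂⁻¹ with hg₂
  have tr₁ : tr g₁ = s := by rw [hg₁, tr_conj, tr_stdForm]
  have tr₂ : tr g₂ = t := by rw [hg₂, tr_conj, tr_stdForm]
  obtain ⟨l, hl, trl, hls⟩ := exists_diag_of_mem_splitTraces hs
  obtain ⟨k, hk⟩ := isConj_iff.1 (isConj_of_tr_eq (tr₁.trans trl.symm) (by rw [tr₁]; exact hs.1))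
  set L := Subgroup.closure {QuotientGroup.mk' (Subgroup.center SL(2, F)) g₁,
    QuotientGroup.mk' (Subgroup.center SL(2, F)) g₂} with hL
  -- Conjugation by k⁻¹ is built in so that the preimage of L contains the diagonal matrix itself.
  let f : SL(2, F) →* Matrix.ProjectiveSpecialLinearGroup (Fin 2) F :=
    (QuotientGroup.mk' (Subgroup.center SL(2, F))).comp (MulAut.conj k⁻¹).toMonoidHom
  have hf : ∀ g, f (k * g * k⁻¹) = QuotientGroup.mk' (Subgroup.center SL(2, F)) g := by
    intro g
    simp only [f, MonoidHom.comp_apply, MulEquiv.toMonoidHom_eq_coe, MonoidHom.coe_coe,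
      MulAut.conj_apply]
    congr 1
    group
  have hfsurj : Function.Surjective f := by
    intro x
    obtain ⟨g, rfl⟩ := QuotientGroup.mk'_surjective _ x
    exact ⟨_, hf g⟩
  have m1 : diag l hl ∈ L.comap f := by
    rw [← hk, Subgroup.mem_comap, hf]
    exact Subgroup.subset_closure (by simp)
  have m2 : k * g₂ * k⁻¹ ∈ L.comap f := by
    rw [Subgroup.mem_comap, hf]
    exact Subgroup.subset_closure (by simp)
  have m3 : -1 ∈ L.comap f := by
    have : f (-1) = 1 := by
      rw [show (-1 : SL(2, F)) = k * (-1) * k⁻¹ by simp, hf]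
      exact (QuotientGroup.eq_one_iff _).2 ((mem_center_iff_eq _).2 (Or.inr rfl))
    rw [Subgroup.mem_comap, this]
    exact L.one_mem
  have hy : ∀ μ : F, μ ^ 2 - tr (k * g₂ * k⁻¹) * μ + 1 ≠ 0 := by rw [tr_conj, tr₂]; exact ht
  have hl12 : l ^ 12 ≠ 1 := by
    intro e
    apply hs'
    refine ⟨algebraMap F _ l, by rw [← map_pow, e, map_one], ?_⟩
    rw [← map_pow, ← map_mul, ← map_sub, ← map_one (algebraMap F (AlgebraicClosure F)),
      ← map_add, hls, map_zero]
  have hy12 : (k * g₂ * k⁻¹) ^ 12 ≠ 1 := by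
    intro e
    have := tr_mem_smallOrderTraces (lower_left_ne_zero hy) e
    rw [tr_conj, tr₂] at this
    exact ht' this
  have htop : L.comap f = ⊤ := by
    rcases eq_top_or_exists_subfield m3 hl m1 hl12 m2 hy hy12 with h | ⟨E, hne, h⟩
    · exact h
    · exfalso
      apply hne
      have e1 := h _ m1
      have e2 := h _ m2
      rw [trl] at e1
      rw [tr_conj, tr₂] at e2
      exact hE E e1 e2
  rw [eq_top_iff]
  intro x _
  obtain ⟨g, rfl⟩ := hfsurj x
  exact Subgroup.mem_comap.1 (htop ▸ Subgroup.mem_top g)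

end Classes

/-! ### Counting traces, classes and exceptional pairs. -/

section Counting

variable {F : Type*} [Field F]

lemma neg_mem_splitTraces {t : F} (h : t ∈ splitTraces F) : -t ∈ splitTraces F := by
  obtain ⟨h4, μ, hμ⟩ := h
  exact ⟨by rwa [neg_sq], -μ, by linear_combination hμ⟩

lemma neg_mem_nonsplitTraces {t : F} (h : t ∈ nonsplitTraces F) : -t ∈ nonsplitTraces F :=
  fun μ hμ => h (-μ) (by linear_combination hμ)

variable [Finite F]

/-- The map μ ↦ μ + μ⁻¹ is two-to-one onto the split traces from the elements other than 0, 1 and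
-1. -/
lemma ncard_splitTraces (F : Type*) [Field F] [Finite F] :
    2 * (splitTraces F).ncard ≤ Nat.card F ∧ Nat.card F ≤ 2 * (splitTraces F).ncard + 3 := by
  classical
  have := Fintype.ofFinite F
  let N : Finset F := Finset.univ.filter fun μ => μ ≠ 0 ∧ μ ^ 2 ≠ 1
  let f : F → F := fun μ => μ + μ⁻¹
  have himg : (N.image f : Set F) = splitTraces F := by
    ext t
    simp only [Finset.coe_image, Set.mem_image, Finset.mem_coe, N, Finset.mem_filter,
      Finset.mem_univ, true_and, f, splitTraces, Set.mem_ofPred_eq]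
    constructor
    · rintro ⟨μ, ⟨h0, h1⟩, rfl⟩
      refine ⟨fun e => h1 ?_, μ, by field_simp; ring⟩
      field_simp at e
      have : (μ ^ 2 - 1) ^ 2 = 0 := by linear_combination e
      exact sub_eq_zero.1 (pow_eq_zero_iff two_ne_zero |>.1 this)
    · rintro ⟨h4, μ, hμ⟩
      have h0 : μ ≠ 0 := by rintro rfl; simp at hμ
      have ht : μ + μ⁻¹ = t := by field_simp; linear_combination hμ
      refine ⟨μ, ⟨h0, fun h1 => h4 ?_⟩, ht⟩
      rw [← ht]
      field_simp
      linear_combination (μ ^ 2 - 1) * h1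
  have hcard : (splitTraces F).ncard = (N.image f).card := by
    rw [← himg, Set.ncard_coe_finset]
  have hfib : ∀ t ∈ N.image f, (N.filter fun μ => f μ = t).card = 2 := by
    intro t ht
    obtain ⟨μ, hμ, rfl⟩ := Finset.mem_image.1 ht
    simp only [N, Finset.mem_filter, Finset.mem_univ, true_and] at hμ
    obtain ⟨h0, h1⟩ := hμ
    have hne : μ ≠ μ⁻¹ := by
      intro e
      apply h1
      rw [sq]
      nth_rewrite 2 [e]
      exact mul_inv_cancel₀ h0
    rw [← Finset.card_pair hne]
    congr 1
    ext ν
    simp only [N, f, Finset.mem_filter, Finset.mem_univ, true_and, Finset.mem_insert,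
      Finset.mem_singleton]
    constructor
    · rintro ⟨⟨hν, -⟩, e⟩
      have : (ν - μ) * (ν - μ⁻¹) = 0 := by
        field_simp at e ⊢
        linear_combination e
      rcases mul_eq_zero.1 this with e | e
      · exact Or.inl (sub_eq_zero.1 e)
      · exact Or.inr (sub_eq_zero.1 e)
    · rintro (rfl | rfl)
      · exact ⟨⟨h0, h1⟩, rfl⟩
      · exact ⟨⟨inv_ne_zero h0, by rwa [inv_pow, ne_eq, inv_eq_one]⟩, by rw [inv_inv, add_comm]⟩
  have hN : N.card = 2 * (N.image f).card := by
    rw [Finset.card_eq_sum_card_image f N, Finset.sum_congr rfl hfib, Finset.sum_const,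
      smul_eq_mul, mul_comm]
  have hle : N.card ≤ Nat.card F := by
    rw [Nat.card_eq_fintype_card]; exact Finset.card_le_univ N
  have hge : Nat.card F ≤ N.card + 3 := by
    rw [Nat.card_eq_fintype_card, ← Finset.card_univ]
    have : (Finset.univ : Finset F) ⊆ N ∪ {0, 1, -1} := by
      intro μ _
      simp only [Finset.mem_union, N, Finset.mem_filter, Finset.mem_univ, true_and,
        Finset.mem_insert, Finset.mem_singleton]
      by_cases h : μ ^ 2 = 1
      · have := eq_one_or_eq_neg_one_of_sq_eq_one h
        tauto
      · tauto
    refine (Finset.card_le_card this).trans ((Finset.card_union_le _ _).trans ?_)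
    have := Finset.card_le_three (a := (0 : F)) (b := 1) (c := -1)
    omega
  rw [hcard]
  omega

lemma ncard_nonsplitTraces (F : Type*) [Field F] [Finite F] :
    (splitTraces F).ncard + (nonsplitTraces F).ncard ≤ Nat.card F ∧
      Nat.card F ≤ (splitTraces F).ncard + (nonsplitTraces F).ncard + 2 := by
  have hdisj : Disjoint (splitTraces F) (nonsplitTraces F) := by
    rw [Set.disjoint_left]
    rintro t ⟨-, μ, hμ⟩ h
    exact h μ hμ
  rw [← Set.ncard_union_eq hdisj (Set.toFinite _) (Set.toFinite _), ← Set.ncard_univ]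
  refine ⟨Set.ncard_le_ncard (Set.subset_univ _) (Set.toFinite _), ?_⟩
  have hsub : (Set.univ : Set F) ⊆ (splitTraces F ∪ nonsplitTraces F) ∪ {2, -2} := by
    intro t _
    by_cases h4 : t ^ 2 = 4
    · right
      exact sq_eq_sq_iff_eq_or_eq_neg.1 (show t ^ 2 = 2 ^ 2 by rw [h4]; norm_num)
    · left
      by_cases h : ∃ μ : F, μ ^ 2 - t * μ + 1 = 0
      · exact Or.inl ⟨h4, h⟩
      · push Not at h
        exact Or.inr h
  refine (Set.ncard_le_ncard hsub (Set.toFinite _)).trans ((Set.ncard_union_le _ _).trans ?_)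
  have : ({2, -2} : Set F).ncard ≤ 2 := by
    refine (Set.ncard_insert_le _ _).trans ?_
    rw [Set.ncard_singleton]
  omega

/-- The fibres are the pairs {t, -t}; only t = 0 can give a singleton, which accounts for the extra
2. -/
lemma ncard_image_of_eq_or_eq_neg {α : Type*} {φ : F → α} {A : Set F} (two : (2 : F) ≠ 0)
    (hA : ∀ t ∈ A, -t ∈ A) (h1 : ∀ s t, φ s = φ t → s = t ∨ s = -t)
    (h2 : ∀ t ∈ A, φ (-t) = φ t) :
    A.ncard ≤ 2 * (φ '' A).ncard ∧ 2 * (φ '' A).ncard ≤ A.ncard + 2 := by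
  classical
  obtain ⟨B, rfl⟩ := (Set.toFinite A).exists_finset_coe
  rw [← Finset.coe_image, Set.ncard_coe_finset, Set.ncard_coe_finset]
  constructor
  · refine Finset.card_le_mul_card_image B 2 fun C hC => ?_
    obtain ⟨t, ht, rfl⟩ := Finset.mem_image.1 hC
    refine (Finset.card_le_card (t := {t, -t}) ?_).trans Finset.card_le_two
    intro s hs
    simpa using h1 _ _ (Finset.mem_filter.1 hs).2
  · have hsub : B.image φ ⊆ insert (φ 0) ((B.erase 0).image φ) := by
      intro C hC
      obtain ⟨t, ht, rfl⟩ := Finset.mem_image.1 hC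
      by_cases h0 : t = 0
      · rw [h0]; exact Finset.mem_insert_self _ _
      · exact Finset.mem_insert_of_mem (Finset.mem_image_of_mem _ (Finset.mem_erase.2 ⟨h0, ht⟩))
    have h3 := (Finset.card_le_card hsub).trans (Finset.card_insert_le _ _)
    have h4 : 2 * ((B.erase 0).image φ).card ≤ (B.erase 0).card := by
      rw [mul_comm, ← smul_eq_mul, Finset.card_eq_sum_card_image φ (B.erase 0)]
      refine Finset.card_nsmul_le_sum _ _ _ fun C hC => ?_
      obtain ⟨t, ht, rfl⟩ := Finset.mem_image.1 hC
      obtain ⟨h0, ht⟩ := Finset.mem_erase.1 ht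
      have hne : t ≠ -t := by
        intro e
        have : 2 * t = 0 := by linear_combination e
        exact (mul_ne_zero two h0) this
      rw [← Finset.card_pair hne]
      apply Finset.card_le_card
      intro s hs
      simp only [Finset.mem_insert, Finset.mem_singleton] at hs
      rw [Finset.mem_filter, Finset.mem_erase]
      rcases hs with rfl | rfl
      · exact ⟨⟨h0, ht⟩, rfl⟩
      · exact ⟨⟨neg_ne_zero.2 h0, hA _ ht⟩, h2 _ ht⟩
    have := Finset.card_erase_le (s := B) (a := 0)
    omega

lemma ncard_image_traceClass {A : Set F} (hA : ∀ t ∈ A, -t ∈ A) (h4 : ∀ t ∈ A, t ^ 2 ≠ 4) {d : ℕ}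
    (hd : d = Nat.gcd 2 (Nat.card F - 1)) :
    A.ncard ≤ d * (traceClass '' A).ncard ∧ d * (traceClass '' A).ncard ≤ A.ncard + 2 := by
  have := Fintype.ofFinite F
  rw [Nat.card_eq_fintype_card] at hd
  have hq : 1 < Fintype.card F := Fintype.one_lt_card
  by_cases h2 : (2 : F) = 0
  · have hchar : ringChar F = 2 := by
      by_contra h
      exact Ring.two_ne_zero h h2
    have hd1 : d = 1 := by
      have := FiniteField.even_card_of_char_two hchar
      rw [hd]
      exact Nat.coprime_two_left.2 (Nat.odd_iff.2 (by omega))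
    have hinj : Set.InjOn traceClass A := by
      intro s _ t _ e
      rcases traceClass_eq_imp e with e | e
      · exact e
      · rw [e]; linear_combination (-t) * h2
    rw [hinj.ncard_image, hd1]
    omega
  · have hchar : ringChar F ≠ 2 := by
      intro h
      apply h2
      have := ringChar.Nat.cast_ringChar (R := F)
      rw [h] at this
      exact_mod_cast this
    have hodd := FiniteField.odd_card_of_char_ne_two hchar
    have hd2 : d = 2 := by
      rw [hd]
      exact Nat.gcd_eq_left (by omega)
    rw [hd2]
    exact ncard_image_of_eq_or_eq_neg h2 hA (fun s t => traceClass_eq_imp)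
      fun t ht => traceClass_neg (h4 t ht)

lemma ncard_smallOrderTraces_le (F : Type*) [Field F] [Finite F] :
    (smallOrderTraces F).ncard ≤ 12 := by
  classical
  let R := (Polynomial.nthRoots 12 (1 : AlgebraicClosure F)).toFinset
  have hR : R.card ≤ 12 :=
    (Multiset.toFinset_card_le _).trans (Polynomial.card_nthRoots 12 _)
  have hsub : algebraMap F (AlgebraicClosure F) '' smallOrderTraces F ⊆
      (R.image fun μ => (μ ^ 2 + 1) / μ : Finset (AlgebraicClosure F)) := by
    rintro _ ⟨t, ⟨μ, h12, hμ⟩, rfl⟩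
    have h0 : μ ≠ 0 := by rintro rfl; simp at hμ
    rw [Finset.mem_coe, Finset.mem_image]
    refine ⟨μ, ?_, ?_⟩
    · rw [Multiset.mem_toFinset, Polynomial.mem_nthRoots (by norm_num)]; exact h12
    · rw [div_eq_iff h0]; linear_combination hμ
  rw [← Set.ncard_image_of_injective _ (algebraMap F (AlgebraicClosure F)).injective]
  refine (Set.ncard_le_ncard hsub (Finset.finite_toSet _)).trans ?_
  rw [Set.ncard_coe_finset]
  exact Finset.card_image_le.trans hR

/-- A subfield of order n is exactly the root set of Xⁿ - X. -/
lemma subfield_eq_of_card_eq {E E' : Subfield F} (h : Nat.card E = Nat.card E') : E = E' := by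
  classical
  have hE1 : 1 < Nat.card E := Finite.one_lt_card
  have key : ∀ L : Subfield F, Nat.card L = Nat.card E → (L : Set F) =
      ((Polynomial.X ^ Nat.card E - Polynomial.X : Polynomial F).roots.toFinset : Set F) := by
    intro L hL
    have := Fintype.ofFinite L
    refine Set.eq_of_subset_of_ncard_le ?_ ?_ (Set.toFinite _)
    · intro x hx
      rw [Finset.mem_coe, Multiset.mem_toFinset, Polynomial.mem_roots
        (FiniteField.X_pow_card_sub_X_ne_zero F hE1)]
      have := congrArg (Subtype.val) (FiniteField.pow_card (⟨x, hx⟩ : L))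
      rw [← Nat.card_eq_fintype_card, hL] at this
      simp only [Polynomial.IsRoot, Polynomial.eval_sub, Polynomial.eval_pow, Polynomial.eval_X]
      rw [sub_eq_zero]
      exact this
    · rw [Set.ncard_coe_finset, ← Nat.card_coe_set_eq]
      refine (Multiset.toFinset_card_le _).trans ((Polynomial.card_roots' _).trans ?_)
      rw [FiniteField.X_pow_card_sub_X_natDegree_eq F hE1]
      exact hL.ge
  exact SetLike.coe_injective ((key E rfl).trans (key E' h.symm).symm)

/-- For x outside E, the sums a + bx with a, b in E are distinct. -/
lemma sq_card_subfield_le {E : Subfield F} (hE : E ≠ ⊤) : Nat.card E ^ 2 ≤ Nat.card F := by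
  obtain ⟨x, hx⟩ : ∃ x, x ∉ E := by
    by_contra! h
    exact hE (eq_top_iff.2 fun x _ => h x)
  rw [sq, ← Nat.card_prod]
  refine Nat.card_le_card_of_injective (fun p : E × E => (p.1 : F) + p.2 * x) ?_
  rintro ⟨a, b⟩ ⟨a', b'⟩ e
  simp only at e
  by_cases hb : b = b'
  · subst hb
    have : (a : F) = a' := by linear_combination e
    rw [Subtype.ext this]
  · exfalso
    apply hx
    have hne : (b' : F) - b ≠ 0 := sub_ne_zero.2 fun h => hb (Subtype.ext h.symm)
    have : x = ((a - a' : E) : F) / ((b' - b : E) : F) := by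
      rw [eq_div_iff (by simpa using hne)]
      push_cast
      linear_combination -e
    rw [this]
    exact E.div_mem (a - a').2 (b' - b).2

lemma sum_range_pow_le {p : ℕ} (hp : 2 ≤ p) (n : ℕ) :
    ∑ i ∈ Finset.range (n + 1), p ^ i ≤ 2 * p ^ n := by
  induction n with
  | zero => simp
  | succ n ih =>
    rw [Finset.sum_range_succ, pow_succ]
    nlinarith [Nat.mul_le_mul_left (p ^ n) hp]

open Classical in
lemma sum_sq_card_subfield_le [Fintype (Subfield F)] :
    ∑ E ∈ (Finset.univ : Finset (Subfield F)).filter (· ≠ ⊤), Nat.card E ^ 2 ≤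
      2 * Nat.card F := by
  have := Fintype.ofFinite F
  obtain ⟨p, hp⟩ := CharP.exists F
  obtain ⟨n, hpp, hn⟩ := FiniteField.card F p
  rw [← Nat.card_eq_fintype_card] at hn
  rw [hn]
  have hinj : Set.InjOn (fun E : Subfield F => Nat.card E ^ 2)
      ((Finset.univ : Finset (Subfield F)).filter (· ≠ ⊤)) := by
    intro E _ E' _ h
    exact subfield_eq_of_card_eq (Nat.pow_left_injective two_ne_zero h)
  have hinj2 : Set.InjOn (fun i : ℕ => p ^ i) (Finset.range (n + 1)) :=
    (Nat.pow_right_injective hpp.two_le).injOn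
  calc _ = ∑ x ∈ ((Finset.univ : Finset (Subfield F)).filter (· ≠ ⊤)).image
          (fun E : Subfield F => Nat.card E ^ 2), x := (Finset.sum_image hinj).symm
    _ ≤ ∑ x ∈ (Finset.range (n + 1)).image (fun i => p ^ i), x := by
        apply Finset.sum_le_sum_of_subset
        intro x hx
        obtain ⟨E, hE, rfl⟩ := Finset.mem_image.1 hx
        rw [Finset.mem_filter] at hE
        have hdvd : Nat.card E ∣ p ^ (n : ℕ) := by
          rw [← hn]
          exact AddSubgroup.card_addSubgroup_dvd_card E.toSubring.toAddSubgroup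
        obtain ⟨j, -, hj⟩ := (Nat.dvd_prime_pow hpp).1 hdvd
        rw [Finset.mem_image]
        refine ⟨j * 2, ?_, by rw [pow_mul, hj]⟩
        rw [Finset.mem_range, Nat.lt_succ_iff]
        have := sq_card_subfield_le hE.2
        rw [hj, hn, ← pow_mul] at this
        exact (Nat.pow_le_pow_iff_right hpp.one_lt).1 this
    _ = ∑ i ∈ Finset.range (n + 1), p ^ i := Finset.sum_image hinj2
    _ ≤ _ := sum_range_pow_le hpp.two_le n

lemma ncard_sq_mem_le (E : Subfield F) : {a : F | a ^ 2 ∈ E}.ncard ≤ 2 * Nat.card E := by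
  classical
  have := Fintype.ofFinite F
  let B : Finset F := Finset.univ.filter (fun a => a ^ 2 ∈ E)
  have hB : {a : F | a ^ 2 ∈ E} = B := by ext a; simp [B]
  have hE : Nat.card E = (Finset.univ.filter (fun a : F => a ∈ E)).card := by
    rw [Nat.card_eq_fintype_card, Fintype.card_subtype]
  rw [hB, Set.ncard_coe_finset]
  refine (Finset.card_le_mul_card_image (f := fun a : F => a ^ 2) B 2 fun b hb => ?_).trans ?_
  · obtain ⟨t, ht, rfl⟩ := Finset.mem_image.1 hb
    refine (Finset.card_le_card (t := {t, -t}) ?_).trans Finset.card_le_two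
    intro s hs
    simpa using sq_eq_sq_iff_eq_or_eq_neg.1 (Finset.mem_filter.1 hs).2
  · apply Nat.mul_le_mul_left
    rw [hE]
    apply Finset.card_le_card
    intro b hb
    obtain ⟨t, ht, rfl⟩ := Finset.mem_image.1 hb
    simpa [B] using ht

/-- Pairs of traces for which generation is not guaranteed. -/
def exceptionalPairs (F : Type*) [Field F] : Set (F × F) :=
  {p | p.1 ∈ smallOrderTraces F ∨ p.2 ∈ smallOrderTraces F ∨
    ∃ E : Subfield F, E ≠ ⊤ ∧ p.1 ^ 2 ∈ E ∧ p.2 ^ 2 ∈ E}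

/-- The constant is 12 + 12 for the small-order traces in either coordinate, plus 8 from the sum of
4|E|² over proper subfields. -/
lemma ncard_exceptionalPairs_le (F : Type*) [Field F] [Finite F] :
    (exceptionalPairs F).ncard ≤ 32 * Nat.card F := by
  classical
  have : Finite (Subfield F) := Finite.of_injective _ (SetLike.coe_injective (A := Subfield F))
  have := Fintype.ofFinite (Subfield F)
  have hsub : exceptionalPairs F ⊆ (smallOrderTraces F ×ˢ Set.univ) ∪
      (Set.univ ×ˢ smallOrderTraces F) ∪
      ⋃ E ∈ (Finset.univ : Finset (Subfield F)).filter (· ≠ ⊤),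
        {a : F | a ^ 2 ∈ E} ×ˢ {a : F | a ^ 2 ∈ E} := by
    rintro ⟨a, b⟩ (h | h | ⟨E, hE, h⟩)
    · exact Or.inl (Or.inl ⟨h, trivial⟩)
    · exact Or.inl (Or.inr ⟨trivial, h⟩)
    · right
      simp only [Set.mem_iUnion]
      exact ⟨E, by simpa using hE, h⟩
  have h12 := ncard_smallOrderTraces_le F
  refine (Set.ncard_le_ncard hsub (Set.toFinite _)).trans ?_
  refine (Set.ncard_union_le _ _).trans ?_
  have h1 := Set.ncard_union_le (smallOrderTraces F ×ˢ (Set.univ : Set F))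
    (Set.univ ×ˢ smallOrderTraces F)
  rw [Set.ncard_prod, Set.ncard_prod, Set.ncard_univ] at h1
  have h2 : (⋃ E ∈ (Finset.univ : Finset (Subfield F)).filter (· ≠ ⊤),
        {a : F | a ^ 2 ∈ E} ×ˢ {a : F | a ^ 2 ∈ E}).ncard ≤ 8 * Nat.card F := by
    refine (Finset.set_ncard_biUnion_le _ _).trans ?_
    calc _ ≤ ∑ E ∈ (Finset.univ : Finset (Subfield F)).filter (· ≠ ⊤), 4 * Nat.card E ^ 2 := by
          apply Finset.sum_le_sum
          intro E _
          rw [Set.ncard_prod]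
          have := ncard_sq_mem_le E
          nlinarith
      _ ≤ _ := by
          rw [← Finset.mul_sum]
          have := sum_sq_card_subfield_le (F := F)
          omega
  have h3 := Nat.mul_le_mul_right (Nat.card F) h12
  rw [mul_comm (Nat.card F)] at h1
  omega

end Counting

/-! ### Upper and lower bounds for the number of invariably generating pairs. -/

section Assembly

variable {F : Type*} [Field F]

lemma disjoint_split_nonsplit :
    Disjoint (traceClass '' splitTraces F) (traceClass '' nonsplitTraces F) := by
  rw [Set.disjoint_left]
  rintro _ ⟨s, ⟨-, μ, hμ⟩, rfl⟩ ⟨t, ht, e⟩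
  rcases traceClass_eq_imp e with rfl | rfl
  · exact ht μ hμ
  · exact ht (-μ) (by linear_combination hμ)

variable [Finite F]

lemma invGenPairs_subset : invGenPairs (Matrix.ProjectiveSpecialLinearGroup (Fin 2) F) ⊆
    ((traceClass '' splitTraces F) ×ˢ (traceClass '' nonsplitTraces F) ∪
      (traceClass '' nonsplitTraces F) ×ˢ (traceClass '' splitTraces F)) ∪
    (irregularClasses F ×ˢ Set.univ ∪ Set.univ ×ˢ irregularClasses F) := by
  rintro ⟨C, D⟩ h
  change InvariablyGenerates {C, D} at h
  rcases class_cases C with hC | hC | hC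
  · exact Or.inr (Or.inl ⟨hC, trivial⟩)
  all_goals rcases class_cases D with hD | hD | hD
  · exact Or.inr (Or.inr ⟨trivial, hD⟩)
  · obtain ⟨s, hs, rfl⟩ := hC
    obtain ⟨t, ht, rfl⟩ := hD
    exact absurd h (not_invariablyGenerates_split hs ht)
  · exact Or.inl (Or.inl ⟨hC, hD⟩)
  · exact Or.inr (Or.inr ⟨trivial, hD⟩)
  · exact Or.inl (Or.inr ⟨hC, hD⟩)
  · obtain ⟨s, hs, rfl⟩ := hC
    obtain ⟨t, ht, rfl⟩ := hD
    exact absurd h (not_invariablyGenerates_nonsplit hs ht)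

lemma subset_invGenPairs :
    ((traceClass '' splitTraces F) ×ˢ (traceClass '' nonsplitTraces F) ∪
      (traceClass '' nonsplitTraces F) ×ˢ (traceClass '' splitTraces F)) \
    ((fun p : F × F => (traceClass p.1, traceClass p.2)) '' exceptionalPairs F ∪
      (fun p : F × F => (traceClass p.2, traceClass p.1)) '' exceptionalPairs F) ⊆
      invGenPairs (Matrix.ProjectiveSpecialLinearGroup (Fin 2) F) := by
  have key : ∀ s ∈ splitTraces F, ∀ t ∈ nonsplitTraces F, (s, t) ∉ exceptionalPairs F →
      InvariablyGenerates {traceClass s, traceClass t} := by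
    intro s hs t ht h
    simp only [exceptionalPairs, Set.mem_ofPred_eq, not_or, not_exists, not_and] at h
    obtain ⟨h1, h2, h3⟩ := h
    refine invariablyGenerates_of_mem hs ht h1 h2 fun E e1 e2 => ?_
    by_contra hne
    exact h3 E hne e1 e2
  rintro _ ⟨⟨⟨s, hs, e1⟩, ⟨t, ht, e2⟩⟩ | ⟨⟨t, ht, e1⟩, ⟨s, hs, e2⟩⟩, hne⟩ <;>
    rw [Set.mem_union, not_or] at hne
  · have e := Prod.ext (x := (traceClass s, traceClass t)) e1 e2
    rw [← e] at hne ⊢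
    exact key s hs t ht fun h => hne.1 ⟨_, h, rfl⟩
  · have e := Prod.ext (x := (traceClass t, traceClass s)) e1 e2
    rw [← e] at hne ⊢
    change InvariablyGenerates _
    rw [Set.pair_comm]
    exact key s hs t ht fun h => hne.2 ⟨_, h, rfl⟩

lemma ncard_mixed_pairs :
    ((traceClass '' splitTraces F) ×ˢ (traceClass '' nonsplitTraces F) ∪
      (traceClass '' nonsplitTraces F) ×ˢ (traceClass '' splitTraces F)).ncard =
    2 * ((traceClass '' splitTraces F).ncard * (traceClass '' nonsplitTraces F).ncard) := by
  rw [Set.ncard_union_eq _ (Set.toFinite _) (Set.toFinite _), Set.ncard_prod, Set.ncard_prod]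
  · ring
  · rw [Set.disjoint_prod]
    exact Or.inl disjoint_split_nonsplit

lemma ncard_univ_classes_le :
    (Set.univ : Set (ConjClasses (Matrix.ProjectiveSpecialLinearGroup (Fin 2) F))).ncard ≤
      3 + ((traceClass '' splitTraces F).ncard + (traceClass '' nonsplitTraces F).ncard) := by
  have hsub : (Set.univ : Set (ConjClasses (Matrix.ProjectiveSpecialLinearGroup (Fin 2) F))) ⊆
      irregularClasses F ∪ (traceClass '' splitTraces F ∪ traceClass '' nonsplitTraces F) :=
    fun C _ => class_cases C
  refine (Set.ncard_le_ncard hsub (Set.toFinite _)).trans ((Set.ncard_union_le _ _).trans ?_)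
  exact Nat.add_le_add (ncard_irregularClasses_le F) (Set.ncard_union_le _ _)

lemma ncard_invGenPairs_le :
    (invGenPairs (Matrix.ProjectiveSpecialLinearGroup (Fin 2) F)).ncard ≤
      2 * ((traceClass '' splitTraces F).ncard * (traceClass '' nonsplitTraces F).ncard) +
      6 * (3 + ((traceClass '' splitTraces F).ncard + (traceClass '' nonsplitTraces F).ncard)) := by
  refine (Set.ncard_le_ncard invGenPairs_subset (Set.toFinite _)).trans
    ((Set.ncard_union_le _ _).trans ?_)
  rw [ncard_mixed_pairs]
  refine Nat.add_le_add_left ((Set.ncard_union_le _ _).trans ?_) _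
  rw [Set.ncard_prod, Set.ncard_prod]
  have h1 := Nat.mul_le_mul (ncard_irregularClasses_le F) (ncard_univ_classes_le (F := F))
  rw [mul_comm (Set.univ.ncard)]
  omega

lemma le_ncard_invGenPairs :
    2 * ((traceClass '' splitTraces F).ncard * (traceClass '' nonsplitTraces F).ncard) ≤
    (invGenPairs (Matrix.ProjectiveSpecialLinearGroup (Fin 2) F)).ncard + 64 * Nat.card F := by
  have h1 := Set.ncard_le_ncard (subset_invGenPairs (F := F)) (Set.toFinite _)
  have h2 := Set.ncard_le_ncard_sdiff_add_ncard
    ((traceClass '' splitTraces F) ×ˢ (traceClass '' nonsplitTraces F) ∪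
      (traceClass '' nonsplitTraces F) ×ˢ (traceClass '' splitTraces F))
    ((fun p : F × F => (traceClass p.1, traceClass p.2)) '' exceptionalPairs F ∪
      (fun p : F × F => (traceClass p.2, traceClass p.1)) '' exceptionalPairs F) (Set.toFinite _)
  rw [ncard_mixed_pairs] at h2
  have h3 := Set.ncard_union_le
    ((fun p : F × F => (traceClass p.1, traceClass p.2)) '' exceptionalPairs F)
    ((fun p : F × F => (traceClass p.2, traceClass p.1)) '' exceptionalPairs F)
  have h4 := Set.ncard_image_le (f := fun p : F × F => (traceClass p.1, traceClass p.2))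
    (Set.toFinite (exceptionalPairs F))
  have h5 := Set.ncard_image_le (f := fun p : F × F => (traceClass p.2, traceClass p.1))
    (Set.toFinite (exceptionalPairs F))
  have h6 := ncard_exceptionalPairs_le F
  omega

lemma abs_sub_le_of_bounds {q d s n P : ℝ} (hq : 4 ≤ q) (hd : 1 ≤ d) (hs : 0 ≤ s) (hn : 0 ≤ n)
    (s1 : q - 3 ≤ 2 * (d * s)) (s2 : 2 * (d * s) ≤ q + 4)
    (n1 : q - 4 ≤ 2 * (d * n)) (n2 : 2 * (d * n) ≤ q + 7)
    (hP : P ≤ 2 * (s * n) + 6 * (3 + (s + n))) (hP' : 2 * (s * n) ≤ P + 64 * q) :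
    |P - q ^ 2 / (2 * d ^ 2)| ≤ 100 * q := by
  have hd2 : 1 ≤ d ^ 2 := one_le_pow₀ hd
  have hpos : 0 < 2 * d ^ 2 := by positivity
  have e : 2 * (s * n) = (2 * (d * s)) * (2 * (d * n)) / (2 * d ^ 2) := by
    field_simp
  have hup : 2 * (s * n) ≤ q ^ 2 / (2 * d ^ 2) + 10 * q := by
    rw [e, div_add' _ _ _ hpos.ne']
    apply div_le_div_of_nonneg_right _ hpos.le
    have := mul_le_mul s2 n2 (by positivity) (by linarith)
    nlinarith
  have hlo : q ^ 2 / (2 * d ^ 2) ≤ 2 * (s * n) + 4 * q := by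
    rw [e, div_add' _ _ _ hpos.ne']
    apply div_le_div_of_nonneg_right _ hpos.le
    have := mul_le_mul s1 n1 (by linarith) (by positivity)
    nlinarith
  have hs' : s ≤ d * s := le_mul_of_one_le_left hs hd
  have hn' : n ≤ d * n := le_mul_of_one_le_left hn hd
  -- The upper error is at most 10q + 18 + 6(q + 11/2) and the lower one at most 4q + 64q, both
  -- below 100q for q ≥ 4.
  rw [abs_le]
  constructor <;> linarith

end Assembly

end SL2Aux

theorem theorem2p7 :
    ∃ K : ℝ, ∀ (F : Type*) [Field F] [Finite F] (q d : ℕ),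
      q = Nat.card F → 4 ≤ q → d = Nat.gcd 2 (q - 1) →
        |((invGenPairs (Matrix.ProjectiveSpecialLinearGroup (Fin 2) F)).ncard : ℝ)
            - (q : ℝ) ^ 2 / (2 * (d : ℝ) ^ 2)| ≤ K * (q : ℝ) := by
  refine ⟨100, fun F _ _ q d hq h4 hd => ?_⟩
  subst hq
  obtain ⟨a1, a2⟩ := SL2Aux.ncard_splitTraces F
  obtain ⟨b1, b2⟩ := SL2Aux.ncard_nonsplitTraces F
  obtain ⟨s1, s2⟩ := SL2Aux.ncard_image_traceClass (F := F)
    (fun t => SL2Aux.neg_mem_splitTraces) (fun t ht => ht.1) hd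
  obtain ⟨n1, n2⟩ := SL2Aux.ncard_image_traceClass (F := F)
    (fun t => SL2Aux.neg_mem_nonsplitTraces)
    (fun t => SL2Aux.sq_ne_four_of_mem_nonsplitTraces) hd
  have hd1 : 1 ≤ d := hd ▸ Nat.gcd_pos_of_pos_left _ two_pos
  have u := SL2Aux.ncard_invGenPairs_le (F := F)
  have l := SL2Aux.le_ncard_invGenPairs (F := F)
  have b3 : Nat.card F ≤ 2 * (d * (SL2Aux.traceClass '' SL2Aux.splitTraces F).ncard) + 3 := by
    omega
  have b4 : 2 * (d * (SL2Aux.traceClass '' SL2Aux.splitTraces F).ncard) ≤ Nat.card F + 4 := by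
    omega
  have b5 : Nat.card F ≤ 2 * (d * (SL2Aux.traceClass '' SL2Aux.nonsplitTraces F).ncard) + 4 := by
    omega
  have b6 : 2 * (d * (SL2Aux.traceClass '' SL2Aux.nonsplitTraces F).ncard) ≤ Nat.card F + 7 := by
    omega
  refine SL2Aux.abs_sub_le_of_bounds (s := (SL2Aux.traceClass '' SL2Aux.splitTraces F).ncard)
    (n := (SL2Aux.traceClass '' SL2Aux.nonsplitTraces F).ncard) (by exact_mod_cast h4)
    (by exact_mod_cast hd1) (Nat.cast_nonneg _) (Nat.cast_nonneg _) ?_ (by exact_mod_cast b4) ?_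
    (by exact_mod_cast b6) (by exact_mod_cast u) (by exact_mod_cast l)
  · rw [sub_le_iff_le_add]; exact_mod_cast b3
  · rw [sub_le_iff_le_add]; exact_mod_cast b5
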